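/- Let $s>2$ and let $V\in C^1(\mathbb R^3;\mathbb R)$ satisfy $V(\mathbf x)>0$ for $|\mathbf x|=1$ and $V(\lambda\mathbf x)=\lambda^sV(\mathbf x)$ for all $\lambda>0$, $\mathbf x\in\mathbb R^3$. Write $\mathbf x=(x,y,z)$, $r^2=x^2+y^2$, and $\mathbf A(\mathbf x)=\tfrac12\Omega\,\mathbf e_z\wedge\mathbf x=\tfrac12\Omega(-y,x,0)$. For $g>0$ and $\Omega\ge 0$ let $$\mathcal E^{\rm GP}_{g,\Omega}[\psi]=\int_{\mathbb R^3}\Big\{|(\mathrm i\nabla+\mathbf A)\psi|^2+\big(V-\tfrac14\Omega^2r^2\big)|\psi|^2+g|\psi|^4\Big\}\,d^3\mathbf x,\qquad E^{\rm GP}_{g,\Omega}=\inf\{\mathcal E^{\rm GP}_{g,\Omega}[\psi]:\ \|\psi\|_2=1\},$$ the infimum being over all $\psi:\mathbb R^3\to\mathbb C$ of finite energy (with $\nabla\psi$ the weak gradient, i.e. $\psi$ and $(\mathrm i\nabla+\mathbf A)\psi$ in $L^2$, and $(V-\frac14\Omega^2r^2)|\psi|^2$ and $|\psi|^4$ integrable),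 and let $$\mathcal E^{\rm TF}_{g,\Omega}[\rho]=\int_{\mathbb R^3}\Big\{V\rho-\tfrac14\Omega^2r^2\rho+g\rho^2\Big\}\,d^3\mathbf x,\qquad E^{\rm TF}_{g,\Omega}=\inf\{\mathcal E^{\rm TF}_{g,\Omega}[\rho]:\ \rho\ge0,\ \|\rho\|_1=1\},$$ the infimum being over all densities $\rho$ for which $(V-\frac14\Omega^2r^2)\rho$ and $\rho^2$ are integrable. Fix $\omega\ge0$ and, for each $g>0$, let $\Omega=g^{(s-2)/(2(s+3))}\,\omega$. Then $E^{\rm TF}_{1,\omega}$ and $E^{\rm GP}_{g,\Omega}$ ($g>0$) are infima of nonempty sets of real numbers that are bounded below, and, as $g\to\infty$, $$g^{-s/(s+3)}\,E^{\rm GP}_{g,\Omega}=E^{\rm TF}_{1,\omega}+O\!\left(g^{-(s+2)/(2(s+3))}\log g\right),$$ where the implied constant may depend on $V$, $s$ and $\omega$. -/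

import Mathlib

open MeasureTheory Filter Asymptotics

namespace RotatingBose

/-- Physical space `ℝ³` with the Euclidean norm. The coordinates `0, 1, 2` are `x, y, z`;
the rotation axis is the `z`-axis. -/
abbrev Space : Type := EuclideanSpace ℝ (Fin 3)

/-- The squared distance `r² = x² + y²` from the rotation axis. -/
def axisDistSq (x : Space) : ℝ := x 0 ^ 2 + x 1 ^ 2

/-- The vector potential `A(x) = ½ Ω e_z ∧ x = ½ Ω (-y, x, 0)`. -/
noncomputable def vectorPotential (Ω : ℝ) (x : Space) : Fin 3 → ℝ :=
  ![-(Ω / 2 * x 1), Ω / 2 * x 0, 0]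

/-- The effective potential `V - ¼ Ω² r²`. -/
noncomputable def effPotential (V : Space → ℝ) (Ω : ℝ) (x : Space) : ℝ :=
  V x - 1 / 4 * Ω ^ 2 * axisDistSq x

/-- `G = (G 0, G 1, G 2)` is the weak (distributional) gradient of `ψ`. -/
structure IsWeakGradient (ψ : Space → ℂ) (G : Fin 3 → Space → ℂ) : Prop where
  locallyIntegrable : LocallyIntegrable ψ volume
  locallyIntegrable_grad : ∀ j, LocallyIntegrable (G j) volume
  integral_eq : ∀ (j : Fin 3) (φ : Space → ℝ), ContDiff ℝ (⊤ : ℕ∞) φ → HasCompactSupport φ →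
    ∫ x, fderiv ℝ φ x (EuclideanSpace.single j 1) • ψ x = -∫ x, φ x • G j x

/-- The `j`-th component of `(i∇ + A) ψ`, where `G` is the weak gradient of `ψ`. -/
noncomputable def covGradient (Ω : ℝ) (ψ : Space → ℂ) (G : Fin 3 → Space → ℂ) (j : Fin 3)
    (x : Space) : ℂ :=
  Complex.I * G j x + (vectorPotential Ω x j : ℂ) * ψ x

/-- The Gross-Pitaevskii functional
`∫ { |(i∇ + A) ψ|² + (V - ¼ Ω² r²) |ψ|² + g |ψ|⁴ }`, where `G` is the weak gradient of `ψ`. -/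
noncomputable def gpFunctional (V : Space → ℝ) (g Ω : ℝ) (ψ : Space → ℂ)
    (G : Fin 3 → Space → ℂ) : ℝ :=
  ∫ x, ((∑ j, ‖covGradient Ω ψ G j x‖ ^ 2) + effPotential V Ω x * ‖ψ x‖ ^ 2 + g * ‖ψ x‖ ^ 4)

/-- `ψ`, with weak gradient `G`, is an `L²`-normalized wave function of finite
Gross-Pitaevskii energy. -/
structure IsGPState (V : Space → ℝ) (Ω : ℝ) (ψ : Space → ℂ) (G : Fin 3 → Space → ℂ) :
    Prop where
  memLp : MemLp ψ 2 volume
  normalized : ∫ x, ‖ψ x‖ ^ 2 = 1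
  weakGradient : IsWeakGradient ψ G
  kinetic : ∀ j, MemLp (covGradient Ω ψ G j) 2 volume
  potential : Integrable (fun x => effPotential V Ω x * ‖ψ x‖ ^ 2) volume
  interaction : Integrable (fun x => ‖ψ x‖ ^ 4) volume

/-- The set of values of the Gross-Pitaevskii functional on normalized wave functions. -/
def gpValues (V : Space → ℝ) (g Ω : ℝ) : Set ℝ :=
  {e | ∃ ψ G, IsGPState V Ω ψ G ∧ e = gpFunctional V g Ω ψ G}

/-- The Gross-Pitaevskii energy `E^GP_{g,Ω}`. -/
noncomputable def gpEnergy (V : Space → ℝ) (g Ω : ℝ) : ℝ := sInf (gpValues V g Ω)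

/-- The Thomas-Fermi functional `∫ { V ρ - ¼ Ω² r² ρ + g ρ² }`. -/
noncomputable def tfFunctional (V : Space → ℝ) (g Ω : ℝ) (ρ : Space → ℝ) : ℝ :=
  ∫ x, (effPotential V Ω x * ρ x + g * ρ x ^ 2)

/-- `ρ` is a nonnegative, `L¹`-normalized density of finite Thomas-Fermi energy. -/
structure IsTFDensity (V : Space → ℝ) (Ω : ℝ) (ρ : Space → ℝ) : Prop where
  nonneg : ∀ᵐ x, 0 ≤ ρ x
  integrable : Integrable ρ volume
  normalized : ∫ x, ρ x = 1
  potential : Integrable (fun x => effPotential V Ω x * ρ x) volume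
  interaction : Integrable (fun x => ρ x ^ 2) volume

/-- The set of values of the Thomas-Fermi functional on normalized densities. -/
def tfValues (V : Space → ℝ) (g Ω : ℝ) : Set ℝ :=
  {e | ∃ ρ, IsTFDensity V Ω ρ ∧ e = tfFunctional V g Ω ρ}

/-- The Thomas-Fermi energy `E^TF_{g,Ω}`. -/
noncomputable def tfEnergy (V : Space → ℝ) (g Ω : ℝ) : ℝ := sInf (tfValues V g Ω)

/-- The angular velocity `Ω = g^{(s-2)/(2(s+3))} ω` that corresponds to the scaled angular
velocity `ω = g^{-(s-2)/(2(s+3))} Ω` at coupling `g`. -/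
noncomputable def angularVelocity (s ω g : ℝ) : ℝ := g ^ ((s - 2) / (2 * (s + 3))) * ω

end RotatingBose

/-! Lengths are rescaled by `l = g ^ (1 / (s + 3))` and the angular velocity by `q = g ^ ((s - 2) /
(2 * (s + 3)))`. Since `V` is homogeneous, the energy becomes `q² l² = g ^ (s / (s + 3))` times `∫
|(iε∇ + A)Φ|² + W|Φ|² + |Φ|⁴` with `W = V - ¼ω²r²` and `ε = (q l²)⁻¹ = g ^ (-(s + 2) / (2 * (s +
3)))`. The claim is that the infimum of this functional lies between `E^TF` and `E^TF + O(ε log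
(1/ε))`.

Lower bound (`tfEnergy_le_gpEnergy`): without the nonnegative kinetic term, the functional is the
Thomas-Fermi functional of the density `|Φ|²`.

Upper bound (`exists_trialState`): the trial state is `f F / √(|F|² + ε)`, normalized. Here `f` is
the square root of the Thomas-Fermi minimizer, smoothed so that `ε ∫ |∇f|²` stays bounded. `F` is a
lattice of plane waves on strips of width of order `√ε`, whose phases nearly cancel `A`, so `|(iε∇ +
A)F|² = O(ε)` everywhere (`sum_norm_covDeriv_vortexLattice_sq_le`). Dividing by the regularized
modulus costs a factor `1 / (|F|² + ε)`, large only near the zeros of `F`. There `|F|²` dominates a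
sum of two squared cosines in independent variables (`norm_sq_vortexLattice_ge`), and averaging over
translations of the lattice gives some lattice for which the weighted integral is `O(log (1/ε))`
(`exists_integral_mul_coreWeight_le`). This two-dimensional logarithm is the one in the error term.
The same integral controls the lost mass, hence the cost of normalizing. -/

namespace RotatingBose

/-! ### Growth of the effective potential. -/

/-- Sublevel sets are bounded. -/
def Coercive (W : Space → ℝ) : Prop := ∀ M : ℝ, ∃ R : ℝ, 0 < R ∧ ∀ x, W x ≤ M → ‖x‖ ≤ R

lemma axisDistSq_le (x : Space) : axisDistSq x ≤ ‖x‖ ^ 2 := by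
  rw [EuclideanSpace.norm_sq_eq, Fin.sum_univ_three]
  simp only [axisDistSq, Real.norm_eq_abs, sq_abs]
  nlinarith [sq_nonneg (x 2)]

lemma contDiff_effPotential {V : Space → ℝ} (hV : ContDiff ℝ 1 V) (Ω : ℝ) :
    ContDiff ℝ 1 (effPotential V Ω) := by
  unfold effPotential axisDistSq
  fun_prop

lemma exists_mul_rpow_le {s : ℝ} (hs : 2 < s) {V : Space → ℝ} (hV : Continuous V)
    (hVpos : ∀ x : Space, ‖x‖ = 1 → 0 < V x)
    (hVhom : ∀ t : ℝ, 0 < t → ∀ x : Space, V (t • x) = t ^ s * V x) :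
    ∃ c : ℝ, 0 < c ∧ ∀ x, c * ‖x‖ ^ s ≤ V x := by
  obtain ⟨c, hc, hcV⟩ := (isCompact_sphere (0 : Space) 1).exists_forall_le' hV.continuousOn
    (a := 0) (fun x hx => hVpos x (by simpa using hx))
  refine ⟨c, hc, fun x => ?_⟩
  rcases eq_or_ne x 0 with rfl | hx
  · have h := hVhom 2 two_pos 0
    rw [smul_zero] at h
    have h2 : (1 : ℝ) < 2 ^ s := Real.one_lt_rpow one_lt_two (by linarith)
    have h0 : V 0 = 0 := by
      have : (2 ^ s - 1) * V 0 = 0 := by linarith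
      rcases mul_eq_zero.1 this with h' | h'
      · linarith
      · exact h'
    rw [h0, norm_zero, Real.zero_rpow (by linarith), mul_zero]
  · have hn : 0 < ‖x‖ := norm_pos_iff.2 hx
    have h := hVhom ‖x‖ hn (‖x‖⁻¹ • x)
    rw [smul_smul, mul_inv_cancel₀ hn.ne', one_smul] at h
    rw [h, mul_comm]
    have := hcV (‖x‖⁻¹ • x) (by simp [norm_smul, hn.ne'])
    gcongr

/-- As `s > 2`, the growth of `V` beats the quadratic centrifugal term for every `Ω`. -/
lemma coercive_effPotential {s : ℝ} (hs : 2 < s) {V : Space → ℝ} (hV : Continuous V)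
    (hVpos : ∀ x : Space, ‖x‖ = 1 → 0 < V x)
    (hVhom : ∀ t : ℝ, 0 < t → ∀ x : Space, V (t • x) = t ^ s * V x) (Ω : ℝ) :
    Coercive (effPotential V Ω) := by
  intro M
  obtain ⟨c, hc, hcV⟩ := exists_mul_rpow_le hs hV hVpos hVhom
  have h1 : Tendsto (fun r : ℝ => r ^ (s - 2)) atTop atTop := tendsto_rpow_atTop (by linarith)
  -- Beyond this radius the potential is at least `(|M| + 1) ‖x‖²`, which exceeds `M` as soon as
  -- `‖x‖ ≥ 1`.
  obtain ⟨R, hR⟩ := eventually_atTop.1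
    (h1.eventually_ge_atTop ((|M| + 1 + 1 / 4 * Ω ^ 2) / c))
  refine ⟨max R 1, by positivity, fun x hx => ?_⟩
  by_contra! hlt
  have hr1 : 1 < ‖x‖ := lt_of_le_of_lt (le_max_right _ _) hlt
  have hr := hR ‖x‖ ((le_max_left _ _).trans hlt.le)
  rw [div_le_iff₀ hc] at hr
  have hsplit : ‖x‖ ^ s = ‖x‖ ^ (s - 2) * ‖x‖ ^ 2 := by
    rw [← Real.rpow_natCast, ← Real.rpow_add (by linarith)]; norm_num
  have h2 := hcV x
  rw [hsplit] at h2
  have h3 := axisDistSq_le x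
  have h4 : 1 ≤ ‖x‖ ^ 2 := by nlinarith
  unfold effPotential at hx
  have h5 : 1 / 4 * Ω ^ 2 * axisDistSq x ≤ 1 / 4 * Ω ^ 2 * ‖x‖ ^ 2 := by gcongr
  have h6 : (|M| + 1) * ‖x‖ ^ 2 ≤ M := by nlinarith [mul_le_mul_of_nonneg_right hr (sq_nonneg ‖x‖)]
  nlinarith [le_abs_self M, abs_nonneg M]

lemma Coercive.bddBelow {W : Space → ℝ} (hW : Coercive W) (hc : Continuous W) :
    ∃ C : ℝ, 0 < C ∧ ∀ x, -C ≤ W x := by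
  obtain ⟨R, -, hR⟩ := hW 0
  obtain ⟨c, hc⟩ := (isCompact_closedBall (0 : Space) R).bddBelow_image hc.continuousOn
  refine ⟨|c| + 1, by positivity, fun x => ?_⟩
  by_cases hx : W x ≤ 0
  · have := hc ⟨x, by simpa using hR x hx, rfl⟩
    linarith [neg_abs_le c]
  · linarith [abs_nonneg c]

/-! ### The Thomas-Fermi minimizer. -/

/-- The Thomas-Fermi profile with chemical potential `μ`. -/
noncomputable def tfProfile (W : Space → ℝ) (μ : ℝ) (x : Space) : ℝ := max ((μ - W x) / 2) 0

section profile

variable {W : Space → ℝ} {μ : ℝ}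

lemma tfProfile_nonneg (x : Space) : 0 ≤ tfProfile W μ x := le_max_right _ _

lemma continuous_tfProfile (hc : Continuous W) : Continuous (tfProfile W μ) := by
  unfold tfProfile; fun_prop

lemma hasCompactSupport_of_eq_zero {E : Type*} [Zero E] (hW : Coercive W) {f : Space → E}
    (hf : ∀ x, μ ≤ W x → f x = 0) : HasCompactSupport f := by
  obtain ⟨R, -, hR⟩ := hW μ
  refine HasCompactSupport.intro (isCompact_closedBall (0 : Space) R) fun x hx => hf x ?_
  by_contra! h
  exact hx (by simpa using hR x h.le)

lemma tfProfile_eq_zero {x : Space} (hx : μ ≤ W x) : tfProfile W μ x = 0 :=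
  max_eq_right (by linarith)

lemma tfProfile_of_le {x : Space} (hx : W x ≤ μ) : tfProfile W μ x = (μ - W x) / 2 :=
  max_eq_left (by linarith)

lemma hasCompactSupport_tfProfile (hW : Coercive W) : HasCompactSupport (tfProfile W μ) :=
  hasCompactSupport_of_eq_zero hW fun _ => tfProfile_eq_zero

lemma integrable_tfProfile (hW : Coercive W) (hc : Continuous W) : Integrable (tfProfile W μ) :=
  (continuous_tfProfile hc).integrable_of_hasCompactSupport (hasCompactSupport_tfProfile hW)

lemma continuous_integral_tfProfile (hW : Coercive W) (hc : Continuous W) :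
    Continuous fun μ => ∫ x, tfProfile W μ x := by
  rw [continuous_iff_continuousAt]
  intro μ₀
  refine continuousAt_of_dominated (bound := tfProfile W (μ₀ + 1))
    (Eventually.of_forall fun μ => (continuous_tfProfile hc).aestronglyMeasurable) ?_
    (integrable_tfProfile hW hc) (Eventually.of_forall fun x => ?_)
  · filter_upwards [Iio_mem_nhds (show μ₀ < μ₀ + 1 by linarith)] with μ hμ
    refine Eventually.of_forall fun x => ?_
    rw [Real.norm_of_nonneg (tfProfile_nonneg x)]
    have : μ < μ₀ + 1 := hμ
    unfold tfProfile
    gcongr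
  · unfold tfProfile; fun_prop

/-- Intermediate value theorem in `μ`: the mass vanishes below the infimum of `W`, and is at least
`1` once the profile is at least `1 / v` on a unit ball of volume `v`. -/
lemma exists_integral_tfProfile_eq_one (hW : Coercive W) (hc : Continuous W) :
    ∃ μ, ∫ x, tfProfile W μ x = 1 := by
  obtain ⟨C, hC, hWC⟩ := hW.bddBelow hc
  obtain ⟨M, hM⟩ := (isCompact_closedBall (0 : Space) 1).bddAbove_image hc.continuousOn
  set B := Metric.closedBall (0 : Space) 1
  set v := volume.real B
  have hv : 0 < v := ENNReal.toReal_pos (Metric.measure_closedBall_pos _ _ one_pos).ne'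
    (isCompact_closedBall _ _).measure_lt_top.ne
  have hlow : ∫ x, tfProfile W (-C) x = 0 := by
    rw [integral_eq_zero_of_ae]
    exact Eventually.of_forall fun x => tfProfile_eq_zero (hWC x)
  have hhigh : 1 ≤ ∫ x, tfProfile W (M + 2 / v) x := by
    calc (1 : ℝ) = ∫ x in B, (1 / v : ℝ) := by
          rw [setIntegral_const]
          change 1 = v • (1 / v)
          rw [smul_eq_mul]; field_simp
      _ ≤ ∫ x in B, tfProfile W (M + 2 / v) x := by
          refine setIntegral_mono_on ?_ (integrable_tfProfile hW hc).integrableOn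
            measurableSet_closedBall fun x hx => ?_
          · exact integrableOn_const (isCompact_closedBall _ _).measure_lt_top.ne
          · have := hM ⟨x, hx, rfl⟩
            refine le_trans ?_ (le_max_left _ _)
            have e : 2 / v = 2 * (1 / v) := by ring
            linarith
      _ ≤ _ := setIntegral_le_integral (integrable_tfProfile hW hc)
          (Eventually.of_forall fun x => tfProfile_nonneg x)
  have := mem_range_of_exists_le_of_exists_ge (continuous_integral_tfProfile hW hc)
    ⟨-C, hlow.le.trans zero_le_one⟩ ⟨_, hhigh⟩
  exact this

lemma integrable_mul_tfProfile (hW : Coercive W) (hc : Continuous W) :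
    Integrable fun x => W x * tfProfile W μ x :=
  (hc.mul (continuous_tfProfile hc)).integrable_of_hasCompactSupport
    ((hasCompactSupport_tfProfile hW).mul_left)

lemma integrable_tfProfile_sq (hW : Coercive W) (hc : Continuous W) :
    Integrable fun x => tfProfile W μ x ^ 2 :=
  ((continuous_tfProfile hc).pow 2).integrable_of_hasCompactSupport
    (hasCompactSupport_of_eq_zero (μ := μ) hW fun x hx => by
      rw [Pi.pow_apply, tfProfile_eq_zero hx]; simp)

/-- The Euler-Lagrange equation `2τ = μ - W`, multiplied by `τ` so that it also holds off the
support. -/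
lemma tfProfile_sq_eq (x : Space) :
    2 * tfProfile W μ x ^ 2 = μ * tfProfile W μ x - W x * tfProfile W μ x := by
  rcases le_total (W x) μ with h | h
  · rw [tfProfile_of_le h]; ring
  · rw [tfProfile_eq_zero h]; ring

lemma integral_mul_tfProfile (hW : Coercive W) (hc : Continuous W)
    (h1 : ∫ x, tfProfile W μ x = 1) :
    ∫ x, W x * tfProfile W μ x = μ - 2 * ∫ x, tfProfile W μ x ^ 2 := by
  have : (fun x => W x * tfProfile W μ x)
      = fun x => μ * tfProfile W μ x - 2 * tfProfile W μ x ^ 2 := by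
    ext x; linarith [tfProfile_sq_eq (W := W) (μ := μ) x]
  rw [this, integral_sub ((integrable_tfProfile hW hc).const_mul _)
    ((integrable_tfProfile_sq hW hc).const_mul _), integral_const_mul, integral_const_mul, h1]
  ring

end profile

section TF

variable {V : Space → ℝ} {ω μ : ℝ}

lemma isTFDensity_tfProfile (hW : Coercive (effPotential V ω))
    (hc : Continuous (effPotential V ω)) (h1 : ∫ x, tfProfile (effPotential V ω) μ x = 1) :
    IsTFDensity V ω (tfProfile (effPotential V ω) μ) where
  nonneg := Eventually.of_forall fun x => tfProfile_nonneg x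
  integrable := integrable_tfProfile hW hc
  normalized := h1
  potential := integrable_mul_tfProfile hW hc
  interaction := integrable_tfProfile_sq hW hc

/-- Pointwise duality: for `ρ ≥ 0` and `τ` the profile, `Wρ + ρ² - μρ + τ² ≥ (ρ - τ)² ≥ 0`. By
`integral_mul_tfProfile` the left side is the energy of `τ` itself when `τ` has mass `1`. -/
lemma le_tfFunctional (hW : Coercive (effPotential V ω))
    (hc : Continuous (effPotential V ω)) {ρ : Space → ℝ}
    (hρ : IsTFDensity V ω ρ) :
    μ - ∫ x, tfProfile (effPotential V ω) μ x ^ 2 ≤ tfFunctional V 1 ω ρ := by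
  set W := effPotential V ω
  have h : ∫ x, (μ * ρ x - tfProfile W μ x ^ 2) ≤ tfFunctional V 1 ω ρ := by
    refine integral_mono_ae ((hρ.integrable.const_mul _).sub (integrable_tfProfile_sq hW hc))
      (hρ.potential.add (hρ.interaction.const_mul 1)) ?_
    filter_upwards [hρ.nonneg] with x hx
    change μ * ρ x - tfProfile W μ x ^ 2 ≤ W x * ρ x + 1 * ρ x ^ 2
    have h2 : (μ - W x) / 2 ≤ tfProfile W μ x := le_max_left _ _
    nlinarith [sq_nonneg (ρ x - tfProfile W μ x)]
  rwa [integral_sub (hρ.integrable.const_mul _) (integrable_tfProfile_sq hW hc),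
    integral_const_mul, hρ.normalized, mul_one] at h

lemma isGLB_tfValues (hW : Coercive (effPotential V ω))
    (hc : Continuous (effPotential V ω)) : IsGLB (tfValues V 1 ω) (tfEnergy V 1 ω) := by
  obtain ⟨μ, hμ⟩ := exists_integral_tfProfile_eq_one hW hc
  refine isGLB_csInf ⟨_, _, isTFDensity_tfProfile hW hc hμ, rfl⟩
    ⟨μ - ∫ x, tfProfile (effPotential V ω) μ x ^ 2, ?_⟩
  rintro e ⟨ρ, hρ, rfl⟩
  exact le_tfFunctional hW hc hρ

lemma le_tfEnergy (hW : Coercive (effPotential V ω))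
    (hc : Continuous (effPotential V ω)) (h1 : ∫ x, tfProfile (effPotential V ω) μ x = 1) :
    μ - ∫ x, tfProfile (effPotential V ω) μ x ^ 2 ≤ tfEnergy V 1 ω := by
  refine le_csInf ⟨_, _, isTFDensity_tfProfile hW hc h1, rfl⟩ ?_
  rintro e ⟨ρ, hρ, rfl⟩
  exact le_tfFunctional hW hc hρ

end TF

/-! ### Smooth states, and bounds that ignore the kinetic energy. -/

/-- The classical gradient. -/
noncomputable def grad (ψ : Space → ℂ) (j : Fin 3) (x : Space) : ℂ :=
  fderiv ℝ ψ x (EuclideanSpace.single j 1)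

lemma continuous_grad {ψ : Space → ℂ} (hψ : ContDiff ℝ 1 ψ) (j : Fin 3) :
    Continuous (grad ψ j) :=
  (hψ.continuous_fderiv one_ne_zero).clm_apply continuous_const

lemma hasCompactSupport_grad {ψ : Space → ℂ} (hψ : HasCompactSupport ψ) (j : Fin 3) :
    HasCompactSupport (grad ψ j) := hψ.fderiv_apply ℝ _

lemma isWeakGradient_grad {ψ : Space → ℂ} (hψ : ContDiff ℝ 1 ψ) :
    IsWeakGradient ψ (grad ψ) where
  locallyIntegrable := hψ.continuous.locallyIntegrable
  locallyIntegrable_grad j := (continuous_grad hψ j).locallyIntegrable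
  integral_eq j φ hφ hφc := by
    have hφ1 : ContDiff ℝ 1 φ := hφ.of_le (by norm_cast)
    have hd : Continuous fun x => fderiv ℝ φ x (EuclideanSpace.single j 1) :=
      (hφ1.continuous_fderiv one_ne_zero).clm_apply continuous_const
    have h := integral_bilinear_fderiv_right_eq_neg_left_of_integrable (μ := volume)
      (B := ContinuousLinearMap.lsmul ℝ ℝ) (f := φ) (g := ψ) (v := EuclideanSpace.single j 1)
      ((hd.smul hψ.continuous).integrable_of_hasCompactSupport
        (hφc.fderiv_apply ℝ (EuclideanSpace.single j 1)).smul_right)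
      ((hφ.continuous.smul (continuous_grad hψ j)).integrable_of_hasCompactSupport hφc.smul_right)
      ((hφ.continuous.smul hψ.continuous).integrable_of_hasCompactSupport hφc.smul_right)
      (fun x _ => hφ1.differentiable one_ne_zero x) (fun x _ => hψ.differentiable one_ne_zero x)
    simp only [ContinuousLinearMap.lsmul_apply] at h
    rw [eq_comm, neg_eq_iff_eq_neg]
    exact h

lemma continuous_vectorPotential (Ω : ℝ) (j : Fin 3) :
    Continuous fun x => vectorPotential Ω x j := by
  fin_cases j <;> simp [vectorPotential] <;> fun_prop

lemma isGPState_of_contDiff {V : Space → ℝ} (hV : Continuous V) (Ω : ℝ) {ψ : Space → ℂ}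
    (hψ : ContDiff ℝ 1 ψ) (hψc : HasCompactSupport ψ) (h1 : ∫ x, ‖ψ x‖ ^ 2 = 1) :
    IsGPState V Ω ψ (grad ψ) where
  memLp := hψ.continuous.memLp_of_hasCompactSupport hψc
  normalized := h1
  weakGradient := isWeakGradient_grad hψ
  kinetic j := by
    have hA := continuous_vectorPotential Ω j
    have hg := continuous_grad hψ j
    have h0 := hψ.continuous
    refine Continuous.memLp_of_hasCompactSupport (by unfold covGradient; fun_prop) ?_
    exact HasCompactSupport.add (hasCompactSupport_grad hψc j).mul_left hψc.mul_left
  potential := by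
    have h0 := hψ.continuous
    refine Continuous.integrable_of_hasCompactSupport
      (by unfold effPotential axisDistSq; fun_prop) ?_
    exact HasCompactSupport.mul_left (hψc.comp_left (g := fun z : ℂ => ‖z‖ ^ 2) (by simp))
  interaction := by
    have h0 := hψ.continuous
    refine Continuous.integrable_of_hasCompactSupport (by fun_prop) ?_
    exact hψc.comp_left (g := fun z : ℂ => ‖z‖ ^ 4) (by simp)

lemma IsGPState.integrable_sq {V : Space → ℝ} {Ω : ℝ} {ψ : Space → ℂ}
    {G : Fin 3 → Space → ℂ} (h : IsGPState V Ω ψ G) : Integrable fun x => ‖ψ x‖ ^ 2 :=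
  (memLp_two_iff_integrable_sq_norm h.memLp.1).1 h.memLp

lemma IsGPState.integral_le_gpFunctional {V : Space → ℝ} {g Ω : ℝ} {ψ : Space → ℂ}
    {G : Fin 3 → Space → ℂ} (h : IsGPState V Ω ψ G) :
    ∫ x, (effPotential V Ω x * ‖ψ x‖ ^ 2 + g * ‖ψ x‖ ^ 4) ≤ gpFunctional V g Ω ψ G := by
  have hk : Integrable fun x => ∑ j, ‖covGradient Ω ψ G j x‖ ^ 2 :=
    integrable_finsetSum _ fun j _ =>
      (memLp_two_iff_integrable_sq_norm (h.kinetic j).1).1 (h.kinetic j)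
  refine integral_mono (h.potential.add (h.interaction.const_mul g))
    ((hk.add h.potential).add (h.interaction.const_mul g)) fun x => ?_
  have : 0 ≤ ∑ j, ‖covGradient Ω ψ G j x‖ ^ 2 := Finset.sum_nonneg fun _ _ => by positivity
  change _ ≤ (∑ j, ‖covGradient Ω ψ G j x‖ ^ 2) + _ + _
  linarith

lemma bddBelow_gpValues {V : Space → ℝ} {g Ω : ℝ} (hg : 0 ≤ g)
    (hW : Coercive (effPotential V Ω)) (hc : Continuous (effPotential V Ω)) :
    BddBelow (gpValues V g Ω) := by
  obtain ⟨C, -, hC⟩ := hW.bddBelow hc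
  refine ⟨-C, ?_⟩
  rintro e ⟨ψ, G, h, rfl⟩
  refine le_trans ?_ h.integral_le_gpFunctional
  calc -C = ∫ x, -C * ‖ψ x‖ ^ 2 := by rw [integral_const_mul, h.normalized, mul_one]
    _ ≤ _ := by
      refine integral_mono (h.integrable_sq.const_mul _)
        (h.potential.add (h.interaction.const_mul g)) fun x => ?_
      have h1 := mul_le_mul_of_nonneg_right (hC x) (sq_nonneg ‖ψ x‖)
      have h2 : 0 ≤ g * ‖ψ x‖ ^ 4 := by positivity
      simp only
      linarith

/-! ### Rescaling to the Thomas-Fermi length. -/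

section scaling

variable {V : Space → ℝ} {ω q l : ℝ}

/-- The hypothesis on `V` is homogeneity with `l ^ s = q² l²`. This makes the potential and the
centrifugal term scale alike. -/
lemma effPotential_smul (hVq : ∀ x, V (l • x) = q ^ 2 * l ^ 2 * V x) (x : Space) :
    effPotential V (q * ω) (l • x) = q ^ 2 * l ^ 2 * effPotential V ω x := by
  simp only [effPotential, axisDistSq, hVq, PiLp.smul_apply, smul_eq_mul]
  ring

lemma integral_comp_smul_space {E : Type*} [NormedAddCommGroup E] [NormedSpace ℝ E]
    (hl : 0 < l) (f : Space → E) : ∫ x, f (l • x) = (l ^ 3)⁻¹ • ∫ x, f x := by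
  rw [Measure.integral_comp_smul, finrank_euclideanSpace_fin, abs_of_pos (by positivity)]

/-- The dilated density `l³ |ψ(l x)|²` is a competitor in the Thomas-Fermi problem; the coupling `q²
l⁵` is the one that becomes `1`. -/
lemma tfEnergy_le_of_isGPState (hq : 0 < q) (hl : 0 < l)
    (hVq : ∀ x, V (l • x) = q ^ 2 * l ^ 2 * V x)
    (hW : Coercive (effPotential V ω)) (hc : Continuous (effPotential V ω))
    {ψ : Space → ℂ} {G : Fin 3 → Space → ℂ} (h : IsGPState V (q * ω) ψ G) :
    q ^ 2 * l ^ 2 * tfEnergy V 1 ω ≤ gpFunctional V (q ^ 2 * l ^ 5) (q * ω) ψ G := by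
  refine le_trans ?_ h.integral_le_gpFunctional
  have hρ : IsTFDensity V ω fun x => l ^ 3 * ‖ψ (l • x)‖ ^ 2 :=
    { nonneg := Eventually.of_forall fun x => by positivity
      integrable := (h.integrable_sq.comp_smul hl.ne').const_mul _
      normalized := by
        rw [integral_const_mul, integral_comp_smul_space hl fun x => ‖ψ x‖ ^ 2, h.normalized]
        simp [hl.ne']
      potential := by
        convert (h.potential.comp_smul hl.ne').const_mul (l ^ 3 / (q ^ 2 * l ^ 2)) using 2 with x
        rw [effPotential_smul hVq]
        field_simp
      interaction := by
        convert (h.interaction.comp_smul hl.ne').const_mul (l ^ 6) using 2 with x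
        ring }
  have key : tfFunctional V 1 ω (fun x => l ^ 3 * ‖ψ (l • x)‖ ^ 2) = (q ^ 2 * l ^ 2)⁻¹ *
      ∫ x, (effPotential V (q * ω) x * ‖ψ x‖ ^ 2 + q ^ 2 * l ^ 5 * ‖ψ x‖ ^ 4) := by
    have e := integral_comp_smul_space hl fun x =>
      effPotential V (q * ω) x * ‖ψ x‖ ^ 2 + q ^ 2 * l ^ 5 * ‖ψ x‖ ^ 4
    rw [smul_eq_mul, eq_comm, inv_mul_eq_iff_eq_mul₀ (by positivity)] at e
    rw [e, ← integral_const_mul, ← integral_const_mul]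
    refine integral_congr_ae (Eventually.of_forall fun x => ?_)
    simp only [effPotential_smul hVq]
    field_simp
  have hle : tfEnergy V 1 ω ≤ tfFunctional V 1 ω (fun x => l ^ 3 * ‖ψ (l • x)‖ ^ 2) :=
    (isGLB_tfValues hW hc).1 ⟨_, hρ, rfl⟩
  rw [key, le_inv_mul_iff₀ (by positivity)] at hle
  exact hle

/-- The `j`-th component of `(i ε ∇ + A) Φ`. -/
noncomputable def covDeriv (ω ε : ℝ) (Φ : Space → ℂ) (j : Fin 3) (x : Space) : ℂ :=
  ε * Complex.I * grad Φ j x + vectorPotential ω x j * Φ x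

/-- The energy functional in rescaled coordinates. -/
noncomputable def scaledFunctional (V : Space → ℝ) (ω ε : ℝ) (Φ : Space → ℂ) : ℝ :=
  ∫ x, ((∑ j, ‖covDeriv ω ε Φ j x‖ ^ 2) + effPotential V ω x * ‖Φ x‖ ^ 2 + ‖Φ x‖ ^ 4)

/-- The `L²`-normalized dilation of `Φ` by the factor `l`. -/
noncomputable def dilate (l : ℝ) (Φ : Space → ℂ) (x : Space) : ℂ :=
  ((√(l ^ 3))⁻¹ : ℝ) • Φ (l⁻¹ • x)

lemma dilate_smul (hl : 0 < l) (Φ : Space → ℂ) (x : Space) :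
    dilate l Φ (l • x) = ((√(l ^ 3))⁻¹ : ℝ) • Φ x := by
  rw [dilate, smul_smul, inv_mul_cancel₀ hl.ne', one_smul]

lemma contDiff_dilate {Φ : Space → ℂ} (hΦ : ContDiff ℝ 1 Φ) : ContDiff ℝ 1 (dilate l Φ) := by
  unfold dilate; fun_prop

lemma grad_dilate_smul (hl : 0 < l) {Φ : Space → ℂ} (hΦ : ContDiff ℝ 1 Φ) (j : Fin 3)
    (x : Space) : grad (dilate l Φ) j (l • x) = ((√(l ^ 3))⁻¹ * l⁻¹ : ℝ) • grad Φ j x := by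
  have h0 : HasFDerivAt Φ (fderiv ℝ Φ x) (l⁻¹ • (l • x)) := by
    rw [smul_smul, inv_mul_cancel₀ hl.ne', one_smul]
    exact (hΦ.differentiable one_ne_zero x).hasFDerivAt
  have h2 : HasFDerivAt (fun y : Space => l⁻¹ • y) (l⁻¹ • ContinuousLinearMap.id ℝ Space)
      (l • x) := (l⁻¹ • ContinuousLinearMap.id ℝ Space).hasFDerivAt
  have h1 : HasFDerivAt (dilate l Φ) _ (l • x) :=
    (h0.comp (l • x) h2).const_smul ((√(l ^ 3))⁻¹ : ℝ)
  rw [grad, h1.fderiv, grad]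
  simp [smul_smul]

lemma hasCompactSupport_dilate (hl : 0 < l) {Φ : Space → ℂ} (hΦ : HasCompactSupport Φ) :
    HasCompactSupport (dilate l Φ) := by
  have h : HasCompactSupport fun x => Φ (l⁻¹ • x) := hΦ.comp_smul (inv_ne_zero hl.ne')
  exact h.smul_left (f := fun _ => (√(l ^ 3))⁻¹)

lemma norm_sq_dilate_smul (hl : 0 < l) (Φ : Space → ℂ) (x : Space) :
    ‖dilate l Φ (l • x)‖ ^ 2 = (l ^ 3)⁻¹ * ‖Φ x‖ ^ 2 := by
  rw [dilate_smul hl, norm_smul, mul_pow, Real.norm_eq_abs, sq_abs, inv_pow,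
    Real.sq_sqrt (by positivity)]

lemma integral_norm_sq_dilate (hl : 0 < l) (Φ : Space → ℂ) :
    ∫ x, ‖dilate l Φ x‖ ^ 2 = ∫ x, ‖Φ x‖ ^ 2 := by
  have e := integral_comp_smul_space hl fun x => ‖dilate l Φ x‖ ^ 2
  simp only [norm_sq_dilate_smul hl, integral_const_mul, smul_eq_mul] at e
  exact (mul_left_cancel₀ (by positivity) e).symm

lemma norm_sq_covGradient_dilate (hq : 0 < q) (hl : 0 < l) {Φ : Space → ℂ}
    (hΦ : ContDiff ℝ 1 Φ) (j : Fin 3) (x : Space) :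
    ‖covGradient (q * ω) (dilate l Φ) (grad (dilate l Φ)) j (l • x)‖ ^ 2
      = q ^ 2 * l ^ 2 * (l ^ 3)⁻¹ * ‖covDeriv ω (q * l ^ 2)⁻¹ Φ j x‖ ^ 2 := by
  have hA : vectorPotential (q * ω) (l • x) j = q * l * vectorPotential ω x j := by
    fin_cases j <;> simp [vectorPotential] <;> ring
  have : covGradient (q * ω) (dilate l Φ) (grad (dilate l Φ)) j (l • x)
      = ((√(l ^ 3))⁻¹ * (q * l) : ℝ) • covDeriv ω (q * l ^ 2)⁻¹ Φ j x := by
    rw [covGradient, covDeriv, grad_dilate_smul hl hΦ, dilate_smul hl, hA]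
    simp only [Complex.real_smul]
    push_cast
    have hl' : (l : ℂ) ≠ 0 := by exact_mod_cast hl.ne'
    have hq' : (q : ℂ) ≠ 0 := by exact_mod_cast hq.ne'
    field_simp
  rw [this, norm_smul, mul_pow, Real.norm_eq_abs, sq_abs, mul_pow, inv_pow,
    Real.sq_sqrt (by positivity)]
  ring

lemma gpFunctional_dilate (hq : 0 < q) (hl : 0 < l)
    (hVq : ∀ x, V (l • x) = q ^ 2 * l ^ 2 * V x) {Φ : Space → ℂ} (hΦ : ContDiff ℝ 1 Φ) :
    gpFunctional V (q ^ 2 * l ^ 5) (q * ω) (dilate l Φ) (grad (dilate l Φ))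
      = q ^ 2 * l ^ 2 * scaledFunctional V ω (q * l ^ 2)⁻¹ Φ := by
  have e := integral_comp_smul_space hl fun x =>
    (∑ j, ‖covGradient (q * ω) (dilate l Φ) (grad (dilate l Φ)) j x‖ ^ 2)
      + effPotential V (q * ω) x * ‖dilate l Φ x‖ ^ 2 + q ^ 2 * l ^ 5 * ‖dilate l Φ x‖ ^ 4
  rw [smul_eq_mul, eq_comm, inv_mul_eq_iff_eq_mul₀ (by positivity)] at e
  rw [gpFunctional, e, scaledFunctional, ← integral_const_mul, ← integral_const_mul]
  refine integral_congr_ae (Eventually.of_forall fun x => ?_)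
  have h4 : ‖dilate l Φ (l • x)‖ ^ 4 = ((l ^ 3)⁻¹ * ‖Φ x‖ ^ 2) ^ 2 := by
    rw [← norm_sq_dilate_smul hl]; ring
  simp only [effPotential_smul hVq, norm_sq_covGradient_dilate hq hl hΦ, h4,
    norm_sq_dilate_smul hl, ← Finset.mul_sum]
  field_simp

end scaling

/-! ### Smoothing the square root of the Thomas-Fermi profile. -/

lemma hasDerivAt_max_zero_sq (t : ℝ) :
    HasDerivAt (fun t : ℝ => max t 0 ^ 2) (2 * max t 0) t := by
  rcases lt_trichotomy t 0 with h | rfl | h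
  · rw [max_eq_right h.le, mul_zero]
    refine (hasDerivAt_const t (0 : ℝ)).congr_of_eventuallyEq ?_
    filter_upwards [Iio_mem_nhds h] with y hy
    rw [max_eq_right (le_of_lt hy)]; norm_num
  · rw [max_self, mul_zero, hasDerivAt_iff_isLittleO_nhds_zero]
    have h2 : (fun h : ℝ => h ^ 2) =o[nhds 0] fun h : ℝ => h := by
      simpa using isLittleO_pow_pow (𝕜 := ℝ) (m := 1) (n := 2) one_lt_two
    refine IsBigO.trans_isLittleO (IsBigO.of_bound 1 (Eventually.of_forall fun x => ?_)) h2
    simp only [zero_add, max_self, smul_zero, sub_zero, one_mul, Real.norm_eq_abs, ne_eq,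
      OfNat.ofNat_ne_zero, not_false_eq_true, zero_pow, abs_pow, sq_abs]
    rcases le_total x 0 with h | h
    · rw [max_eq_right h]; simpa using sq_nonneg x
    · rw [max_eq_left h]
  · rw [max_eq_left h.le]
    refine (((hasDerivAt_id t).pow 2).congr_deriv (by simp)).congr_of_eventuallyEq ?_
    filter_upwards [Ioi_mem_nhds h] with y hy
    rw [max_eq_left (le_of_lt hy)]; rfl

lemma contDiff_max_zero_sq : ContDiff ℝ 1 fun t : ℝ => max t 0 ^ 2 := by
  rw [contDiff_one_iff_deriv]
  refine ⟨fun t => (hasDerivAt_max_zero_sq t).differentiableAt, ?_⟩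
  have : deriv (fun t : ℝ => max t 0 ^ 2) = fun t => 2 * max t 0 :=
    funext fun t => (hasDerivAt_max_zero_sq t).deriv
  rw [this]; fun_prop

/-- A `C¹` regularization of the square root of the positive part, on the scale `ε`. -/
noncomputable def smoothSqrt (ε t : ℝ) : ℝ :=
  max t 0 ^ 2 * (max t 0 ^ 2 + ε ^ 2) ^ (-(3 / 4) : ℝ)

section smoothSqrt

variable {ε : ℝ}

lemma smoothSqrt_nonneg (t : ℝ) : 0 ≤ smoothSqrt ε t := by unfold smoothSqrt; positivity

lemma smoothSqrt_of_nonpos {t : ℝ} (ht : t ≤ 0) : smoothSqrt ε t = 0 := by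
  simp [smoothSqrt, max_eq_right ht]

lemma contDiff_smoothSqrt (hε : 0 < ε) : ContDiff ℝ 1 (smoothSqrt ε) := by
  refine contDiff_max_zero_sq.mul
    ((contDiff_max_zero_sq.add contDiff_const).rpow_const_of_ne fun t => ?_)
  positivity

lemma rpow_neg_quarter_pow {y : ℝ} (hy : 0 < y) (n : ℕ) :
    (y ^ (-(1 / 4) : ℝ)) ^ n = y ^ (-(n / 4) : ℝ) := by
  rw [← Real.rpow_natCast, ← Real.rpow_mul hy.le]; ring_nf

/-- With `w = (p² + ε²) ^ (-1/4)`, the numbers `r = p w²` and `e = ε w²` satisfy `r² + e² = 1`, and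
the squared function is `p r³`. All estimates become polynomial in `r` and `e`. -/
lemma smoothSqrt_sq_bounds (hε : 0 < ε) (t : ℝ) :
    smoothSqrt ε t ^ 2 ≤ max t 0 ∧ max t 0 ≤ smoothSqrt ε t ^ 2 + 3 / 2 * ε := by
  unfold smoothSqrt
  set p := max t 0 with hp
  have hp0 : 0 ≤ p := le_max_right _ _
  have hy : 0 < p ^ 2 + ε ^ 2 := by positivity
  set w := (p ^ 2 + ε ^ 2) ^ (-(1 / 4) : ℝ) with hw
  have hw0 : 0 < w := Real.rpow_pos_of_pos hy _
  have h3 : (p ^ 2 + ε ^ 2) ^ (-(3 / 4) : ℝ) = w ^ 3 := by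
    rw [hw, rpow_neg_quarter_pow hy]; norm_num
  have h4 : w ^ 4 * (p ^ 2 + ε ^ 2) = 1 := by
    rw [hw, rpow_neg_quarter_pow hy, show (-((4 : ℕ) / 4) : ℝ) = -1 by norm_num,
      Real.rpow_neg_one]
    exact inv_mul_cancel₀ hy.ne'
  rw [h3]
  set r := p * w ^ 2
  set e := ε * w ^ 2
  have hr0 : 0 ≤ r := by positivity
  have he0 : 0 ≤ e := by positivity
  have hre : r ^ 2 + e ^ 2 = 1 := by rw [← h4]; ring
  have hr1 : r ≤ 1 := by nlinarith [sq_nonneg e]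
  have he1 : e ≤ 1 := by nlinarith [sq_nonneg r]
  have hf : (p ^ 2 * w ^ 3) ^ 2 = p * r ^ 3 := by ring
  rw [hf]
  constructor
  · exact mul_le_of_le_one_right hp0 (pow_le_one₀ hr0 hr1)
  -- The difference of the two sides is `(1 - r)² (1 + 2r) / 2`.
  · have h5 : 1 - r ^ 3 ≤ 3 / 2 * e ^ 2 := by nlinarith [mul_nonneg (sq_nonneg (r - 1)) hr0]
    have h6 : p * e ^ 2 = ε * (r * e) := by ring
    have h7 : r * e ≤ 1 := mul_le_one₀ hr1 he0 he1
    nlinarith [mul_le_mul_of_nonneg_left h5 hp0, mul_le_mul_of_nonneg_left h7 hε.le]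

lemma deriv_smoothSqrt_sq_le (hε : 0 < ε) (t : ℝ) :
    ε * deriv (smoothSqrt ε) t ^ 2 ≤ 4 := by
  have hQ := hasDerivAt_max_zero_sq t
  have hy : 0 < max t 0 ^ 2 + ε ^ 2 := by positivity
  have hd : HasDerivAt (smoothSqrt ε) _ t :=
    hQ.mul ((hQ.add_const (ε ^ 2)).rpow_const (p := (-(3 / 4) : ℝ)) (Or.inl hy.ne'))
  rw [hd.deriv]
  set p := max t 0 with hp
  have hp0 : 0 ≤ p := le_max_right _ _
  set w := (p ^ 2 + ε ^ 2) ^ (-(1 / 4) : ℝ) with hw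
  have hw0 : 0 < w := Real.rpow_pos_of_pos hy _
  have h3 : (p ^ 2 + ε ^ 2) ^ (-(3 / 4) : ℝ) = w ^ 3 := by
    rw [hw, rpow_neg_quarter_pow hy]; norm_num
  have h7 : (p ^ 2 + ε ^ 2) ^ (-(3 / 4) - 1 : ℝ) = w ^ 7 := by
    rw [hw, rpow_neg_quarter_pow hy]; norm_num
  have h4 : w ^ 4 * (p ^ 2 + ε ^ 2) = 1 := by
    rw [hw, rpow_neg_quarter_pow hy, show (-((4 : ℕ) / 4) : ℝ) = -1 by norm_num,
      Real.rpow_neg_one]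
    exact inv_mul_cancel₀ hy.ne'
  rw [h3, h7]
  set r := p * w ^ 2 with hr
  set e := ε * w ^ 2 with he
  have hr0 : 0 ≤ r := by positivity
  have he0 : 0 ≤ e := by positivity
  have hre : r ^ 2 + e ^ 2 = 1 := by rw [← h4]; ring
  have hr1 : r ≤ 1 := by nlinarith [sq_nonneg e]
  have he1 : e ≤ 1 := by nlinarith [sq_nonneg r]
  have key : ε * (2 * p * w ^ 3 + p ^ 2 * (2 * p * (-(3 / 4)) * w ^ 7)) ^ 2
      = 4 * (e * (r * (1 - 3 / 4 * r ^ 2)) ^ 2) := by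
    rw [hr, he]; ring
  rw [key]
  have h8 : r * (1 - 3 / 4 * r ^ 2) ≤ 1 := by nlinarith [mul_nonneg hr0 (sq_nonneg r)]
  have h9 : 0 ≤ r * (1 - 3 / 4 * r ^ 2) := mul_nonneg hr0 (by nlinarith)
  have := mul_le_one₀ he1 (by positivity) (pow_le_one₀ h9 h8 (n := 2))
  linarith

end smoothSqrt

/-- A regularized square root of the Thomas-Fermi profile: an amplitude with controlled gradient. -/
noncomputable def amplitude (W : Space → ℝ) (μ ε : ℝ) (x : Space) : ℝ :=
  smoothSqrt ε ((μ - W x) / 2)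

section amplitude

variable {W : Space → ℝ} {μ ε : ℝ}

lemma contDiff_amplitude (hW : ContDiff ℝ 1 W) (hε : 0 < ε) :
    ContDiff ℝ 1 (amplitude W μ ε) :=
  (contDiff_smoothSqrt hε).comp ((contDiff_const.sub hW).div_const 2)

lemma amplitude_nonneg (x : Space) : 0 ≤ amplitude W μ ε x := smoothSqrt_nonneg _

lemma amplitude_eq_zero {x : Space} (hx : μ ≤ W x) : amplitude W μ ε x = 0 :=
  smoothSqrt_of_nonpos (by linarith)

lemma amplitude_sq_le (hε : 0 < ε) (x : Space) : amplitude W μ ε x ^ 2 ≤ tfProfile W μ x :=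
  (smoothSqrt_sq_bounds hε _).1

lemma tfProfile_le_amplitude_sq (hε : 0 < ε) (x : Space) :
    tfProfile W μ x ≤ amplitude W μ ε x ^ 2 + 3 / 2 * ε :=
  (smoothSqrt_sq_bounds hε _).2

/-- The bound `4` of `deriv_smoothSqrt_sq_le` is compensated by the square of the factor `1/2` in
`(μ - W) / 2`. -/
lemma fderiv_amplitude_sq_le (hW : ContDiff ℝ 1 W) (hε : 0 < ε) (x v : Space) :
    ε * fderiv ℝ (amplitude W μ ε) x v ^ 2 ≤ fderiv ℝ W x v ^ 2 := by
  have h1 : HasFDerivAt (fun x => (μ - W x) / 2) ((2 : ℝ)⁻¹ • (-fderiv ℝ W x)) x := by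
    have := ((hW.differentiable one_ne_zero x).hasFDerivAt.const_sub μ).const_smul ((2 : ℝ)⁻¹)
    refine this.congr_of_eventuallyEq (Eventually.of_forall fun y => ?_)
    simp only [Pi.smul_apply, smul_eq_mul]; ring
  have h2 : HasDerivAt (smoothSqrt ε) (deriv (smoothSqrt ε) ((μ - W x) / 2)) ((μ - W x) / 2) :=
    ((contDiff_smoothSqrt hε).differentiable one_ne_zero _).hasDerivAt
  have h3 : HasFDerivAt (amplitude W μ ε) _ x := h2.comp_hasFDerivAt x h1
  have h4 := deriv_smoothSqrt_sq_le hε ((μ - W x) / 2)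
  rw [h3.fderiv]
  simp only [_root_.smul_apply, _root_.neg_apply, smul_eq_mul]
  nlinarith [mul_le_mul_of_nonneg_right h4 (sq_nonneg (fderiv ℝ W x v))]

/-- Such an `x` is a global minimum of a nonnegative function. -/
lemma fderiv_amplitude_eq_zero {x : Space} (hx : μ ≤ W x) :
    fderiv ℝ (amplitude W μ ε) x = 0 := by
  refine IsLocalMin.fderiv_eq_zero (Eventually.of_forall fun y => ?_)
  rw [amplitude_eq_zero hx]
  exact amplitude_nonneg y

lemma hasCompactSupport_amplitude (hW : Coercive W) : HasCompactSupport (amplitude W μ ε) :=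
  hasCompactSupport_of_eq_zero hW fun _ => amplitude_eq_zero

lemma exists_integral_fderiv_amplitude_le (hW : Coercive W) (hW1 : ContDiff ℝ 1 W) (μ : ℝ) :
    ∃ C : ℝ, 0 ≤ C ∧ ∀ ε : ℝ, 0 < ε →
      ε * ∫ x, ∑ j, fderiv ℝ (amplitude W μ ε) x (EuclideanSpace.single j 1) ^ 2 ≤ C := by
  obtain ⟨R, -, hR⟩ := hW μ
  have hcW (j : Fin 3) : Continuous fun x => fderiv ℝ W x (EuclideanSpace.single j 1) :=
    (hW1.continuous_fderiv one_ne_zero).clm_apply continuous_const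
  refine ⟨∫ x in Metric.closedBall 0 R, ∑ j, fderiv ℝ W x (EuclideanSpace.single j 1) ^ 2,
    integral_nonneg fun x => Finset.sum_nonneg fun _ _ => sq_nonneg _, fun ε hε => ?_⟩
  rw [← integral_const_mul, ← integral_indicator measurableSet_closedBall]
  refine integral_mono_of_nonneg (Eventually.of_forall fun x => ?_) ?_
    (Eventually.of_forall fun x => ?_)
  · exact mul_nonneg hε.le (Finset.sum_nonneg fun _ _ => sq_nonneg _)
  · rw [integrable_indicator_iff measurableSet_closedBall]
    exact ContinuousOn.integrableOn_compact (isCompact_closedBall _ _)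
      (Continuous.continuousOn (by fun_prop))
  · simp only
    by_cases hx : μ ≤ W x
    · rw [fderiv_amplitude_eq_zero hx]
      simp only [_root_.zero_apply, ne_eq, OfNat.ofNat_ne_zero, not_false_eq_true,
        zero_pow, Finset.sum_const_zero, mul_zero]
      exact Set.indicator_nonneg (fun _ _ => Finset.sum_nonneg fun _ _ => sq_nonneg _) _
    · rw [Set.indicator_of_mem (by simpa using hR x (not_le.1 hx).le), Finset.mul_sum]
      exact Finset.sum_le_sum fun j _ => fderiv_amplitude_sq_le hW1 hε _ _

lemma exists_integral_tfProfile_sub_amplitude_sq_le (hW : Coercive W) (μ : ℝ) :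
    ∃ C : ℝ, 0 ≤ C ∧ ∀ ε : ℝ, 0 < ε →
      ∫ x, (tfProfile W μ x - amplitude W μ ε x ^ 2) ≤ C * ε := by
  obtain ⟨R, -, hR⟩ := hW μ
  refine ⟨3 / 2 * volume.real (Metric.closedBall (0 : Space) R), by positivity, fun ε hε => ?_⟩
  calc _ ≤ ∫ x, (Metric.closedBall (0 : Space) R).indicator (fun _ => 3 / 2 * ε) x := by
        refine integral_mono_of_nonneg (Eventually.of_forall fun x => ?_) ?_
          (Eventually.of_forall fun x => ?_)
        · exact sub_nonneg.2 (amplitude_sq_le hε x)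
        · rw [integrable_indicator_iff measurableSet_closedBall]
          exact integrableOn_const (isCompact_closedBall _ _).measure_lt_top.ne
        · simp only
          by_cases hx : μ ≤ W x
          · rw [tfProfile_eq_zero hx, amplitude_eq_zero hx]
            simpa using Set.indicator_nonneg (fun _ _ => by positivity) _
          · rw [Set.indicator_of_mem (by simpa using hR x (not_le.1 hx).le)]
            linarith [tfProfile_le_amplitude_sq (W := W) (μ := μ) hε x]
    _ = _ := by
        rw [integral_indicator measurableSet_closedBall, setIntegral_const, smul_eq_mul]
        ring

end amplitude

/-! ### The vortex lattice. -/

/-- A `C¹` bump function supported in `[-1, 1]`. -/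
noncomputable def bump (t : ℝ) : ℝ := max (1 - t ^ 2) 0 ^ 2

lemma hasDerivAt_bump (t : ℝ) : HasDerivAt bump (-4 * t * max (1 - t ^ 2) 0) t := by
  have h : HasDerivAt (fun t : ℝ => 1 - t ^ 2) (-(2 * t)) t := by
    simpa using ((hasDerivAt_id t).pow 2).const_sub 1
  have h2 : HasDerivAt bump (2 * max (1 - t ^ 2) 0 * -(2 * t)) t :=
    HasDerivAt.comp t (h₂ := fun t : ℝ => max t 0 ^ 2) (hasDerivAt_max_zero_sq (1 - t ^ 2)) h
  exact h2.congr_deriv (by ring)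

lemma contDiff_bump : ContDiff ℝ 1 bump :=
  contDiff_max_zero_sq.comp (by fun_prop : ContDiff ℝ 1 fun t : ℝ => 1 - t ^ 2)

lemma bump_of_abs_le {t : ℝ} (ht : |t| ≤ 1) : bump t = (1 - t ^ 2) ^ 2 := by
  rw [bump, max_eq_left]
  have := sq_abs t
  nlinarith [abs_nonneg t]

lemma max_one_sub_sq_eq_zero {t : ℝ} (ht : 1 ≤ |t|) : max (1 - t ^ 2) 0 = 0 := by
  rw [max_eq_right]
  have := sq_abs t
  nlinarith

lemma bump_eq_zero {t : ℝ} (ht : 1 ≤ |t|) : bump t = 0 := by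
  rw [bump, max_one_sub_sq_eq_zero ht]; norm_num

lemma max_one_sub_sq_le_one (t : ℝ) : max (1 - t ^ 2) 0 ≤ 1 :=
  max_le (by nlinarith [sq_nonneg t]) zero_le_one

lemma bump_nonneg (t : ℝ) : 0 ≤ bump t := sq_nonneg _

lemma bump_le_one (t : ℝ) : bump t ≤ 1 :=
  pow_le_one₀ (le_max_right _ _) (max_one_sub_sq_le_one t)

lemma eq_floor_or_eq_of_abs_sub_lt {t : ℝ} {k : ℤ} (h : |t - k| < 1) :
    k = ⌊t⌋ ∨ k = ⌊t⌋ + 1 := by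
  obtain ⟨h1, h2⟩ := abs_lt.1 h
  have h3 : ⌊t⌋ < k + 1 := by
    rw [Int.floor_lt]; push_cast; linarith
  have h4 : k - 1 ≤ ⌊t⌋ := by
    rw [Int.le_floor]; push_cast; linarith
  omega

/-- At most two strips overlap at any point, so bounds on the lattice do not depend on the number of
waves. -/
lemma norm_sum_le_two_mul {h : ℤ → ℂ} {M t : ℝ} (hM : ∀ k, ‖h k‖ ≤ M)
    (h0 : ∀ k : ℤ, 1 ≤ |t - k| → h k = 0) (S : Finset ℤ) : ‖∑ k ∈ S, h k‖ ≤ 2 * M := by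
  have hM0 : 0 ≤ M := (norm_nonneg _).trans (hM 0)
  calc ‖∑ k ∈ S, h k‖ ≤ ∑ k ∈ S, ‖h k‖ := norm_sum_le _ _
    _ = ∑ k ∈ S with k ∈ ({⌊t⌋, ⌊t⌋ + 1} : Finset ℤ), ‖h k‖ := by
        rw [Finset.sum_filter_of_ne]
        intro k _ hk
        by_contra hne
        refine hk (norm_eq_zero.2 (h0 k ?_))
        by_contra! hlt
        exact hne (by simpa using eq_floor_or_eq_of_abs_sub_lt hlt)
    _ ≤ ∑ k ∈ ({⌊t⌋, ⌊t⌋ + 1} : Finset ℤ), ‖h k‖ := by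
        refine Finset.sum_le_sum_of_subset_of_nonneg (fun k hk => (Finset.mem_filter.1 hk).2)
          fun _ _ _ => norm_nonneg _
    _ ≤ ∑ k ∈ ({⌊t⌋, ⌊t⌋ + 1} : Finset ℤ), M := Finset.sum_le_sum fun k _ => hM k
    _ ≤ 2 * M := by
        rw [Finset.sum_const, nsmul_eq_mul]
        have : (({⌊t⌋, ⌊t⌋ + 1} : Finset ℤ).card : ℝ) ≤ 2 := by exact_mod_cast Finset.card_le_two
        gcongr

/-- For positive amplitudes, two overlapping waves cancel only where the amplitudes agree and the
phases are opposite: these are the vortices. -/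
lemma norm_sq_add_mul_exp (a b φ ψ : ℝ) :
    ‖a • Complex.exp (φ * Complex.I) + b • Complex.exp (ψ * Complex.I)‖ ^ 2
      = (a - b) ^ 2 + 4 * (a * b) * Real.cos ((φ - ψ) / 2) ^ 2 := by
  have h : Real.cos ((φ - ψ) / 2) ^ 2
      = 1 / 2 + (Real.cos φ * Real.cos ψ + Real.sin φ * Real.sin ψ) / 2 := by
    rw [Real.cos_sq, mul_div_cancel₀ _ two_ne_zero, Real.cos_sub]
  rw [h, Complex.sq_norm, Complex.normSq_apply]
  simp only [Complex.real_smul, Complex.add_re, Complex.add_im, Complex.re_ofReal_mul,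
    Complex.im_ofReal_mul, Complex.exp_ofReal_mul_I_re, Complex.exp_ofReal_mul_I_im]
  linear_combination a ^ 2 * Real.sin_sq_add_cos_sq φ + b ^ 2 * Real.sin_sq_add_cos_sq ψ

/-- Both sides are polynomials in `q = τ (1 - τ) ∈ [0, 1/4]` and affine in `d`. Away from `τ = 1/2`
the amplitude gap suffices; near it the product of the bumps is bounded below. -/
lemma bump_interpolation_lower_bound {τ d : ℝ} (h0 : 0 ≤ τ) (h1 : τ ≤ 1) (hd0 : 0 ≤ d)
    (hd1 : d ≤ 1) : 1 / 8 * (4 * (1 - 2 * τ) ^ 2 + d)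
      ≤ (bump τ - bump (τ - 1)) ^ 2 + 4 * (bump τ * bump (τ - 1)) * d := by
  rw [bump_of_abs_le (by rw [abs_of_nonneg h0]; exact h1),
    bump_of_abs_le (by rw [abs_le]; constructor <;> linarith)]
  obtain ⟨q, hq⟩ : ∃ q, q = τ * (1 - τ) := ⟨_, rfl⟩
  have hq0 : 0 ≤ q := hq ▸ mul_nonneg h0 (by linarith)
  have hq1 : 0 ≤ 1 - 4 * q := by rw [hq]; nlinarith [sq_nonneg (1 - 2 * τ)]
  have e1 : ((1 - τ ^ 2) ^ 2 - (1 - (τ - 1) ^ 2) ^ 2) ^ 2 = (1 - 4 * q) * (1 + 2 * q) ^ 2 := by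
    rw [hq]; ring
  have e2 : (1 - τ ^ 2) ^ 2 * (1 - (τ - 1) ^ 2) ^ 2 = (q * (2 + q)) ^ 2 := by rw [hq]; ring
  have e3 : (1 - 2 * τ) ^ 2 = 1 - 4 * q := by rw [hq]; ring
  rw [e1, e2, e3]
  have hA : (1 - 4 * q) * (1 / 2) ≤ (1 - 4 * q) * (1 + 2 * q) ^ 2 := by
    gcongr; nlinarith
  have hB : 1 / 8 ≤ (1 - 4 * q) * (1 / 2) + 4 * (q * (2 + q)) ^ 2 := by
    nlinarith [sq_nonneg (4 * q - 1 / 4), mul_nonneg hq0 (sq_nonneg q), sq_nonneg (q ^ 2)]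
  nlinarith [mul_le_mul_of_nonneg_left hB hd0, mul_le_mul_of_nonneg_left hA hd0,
    mul_nonneg (sub_nonneg.2 hd1) (sub_nonneg.2 hA)]

/-- Trades the distance to the middle of the overlap for a periodic function, so that both
coordinates enter the core weight in the same way. -/
lemma cos_pi_mul_sq_le (t : ℝ) : Real.cos (Real.pi * t) ^ 2 ≤ 4 * (1 - 2 * Int.fract t) ^ 2 := by
  have h : Real.cos (Real.pi * t) ^ 2 = Real.sin (Real.pi * (1 / 2 - Int.fract t)) ^ 2 := by
    have e : Real.pi * (1 / 2 - Int.fract t) = Real.pi / 2 - (Real.pi * t - ⌊t⌋ * Real.pi) := by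
      rw [← Int.self_sub_floor]; ring
    rw [e, Real.sin_pi_div_two_sub, Real.cos_sub_int_mul_pi, mul_pow]
    have : ((-1 : ℝ) ^ ⌊t⌋) ^ 2 = 1 := by
      rw [← zpow_natCast, ← zpow_mul, mul_comm, zpow_mul]; norm_num
    rw [this, one_mul]
  rw [h, ← sq_abs (Real.sin _)]
  have h1 : |Real.sin (Real.pi * (1 / 2 - Int.fract t))| ≤ |2 * (1 - 2 * Int.fract t)| := by
    refine Real.abs_sin_le_abs.trans ?_
    rw [show (2 : ℝ) * (1 - 2 * Int.fract t) = 4 * (1 / 2 - Int.fract t) by ring, abs_mul, abs_mul,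
      abs_of_pos Real.pi_pos, abs_of_pos (four_pos : (0 : ℝ) < 4)]
    gcongr
    exact Real.pi_le_four
  calc _ ≤ |2 * (1 - 2 * Int.fract t)| ^ 2 := by gcongr
    _ = _ := by rw [sq_abs]; ring

/-- The strip coordinate, in which the `k`-th plane wave lives on `(k - 1, k + 1)`. -/
noncomputable def stripCoord (l a : ℝ) (x : Space) : ℝ := (x 1 / l + a) / Real.pi

/-- The phase of the `k`-th plane wave. -/
noncomputable def wavePhase (ω l a b : ℝ) (k : ℤ) (x : Space) : ℝ :=
  ω / (2 * l ^ 2) * (x 0 * x 1) - ω / l * (Real.pi * k - a) * x 0 - 2 * b * k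

/-- The `k`-th plane wave, localized to its strip. -/
noncomputable def stripWave (ω l a b : ℝ) (k : ℤ) (x : Space) : ℂ :=
  bump (stripCoord l a x - k) • Complex.exp (wavePhase ω l a b k x * Complex.I)

/-- A vortex lattice with mesh of order `l`; the parameters `a`, `b` translate it. -/
noncomputable def vortexLattice (ω l a b : ℝ) (K : ℕ) (x : Space) : ℂ :=
  ∑ k ∈ Finset.Icc (-(K : ℤ)) K, stripWave ω l a b k x

section lattice

variable {ω l a b : ℝ} {K : ℕ}

lemma contDiff_stripWave (k : ℤ) : ContDiff ℝ 1 (stripWave ω l a b k) := by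
  have h1 : ContDiff ℝ 1 fun x : Space => stripCoord l a x - k := by
    unfold stripCoord; fun_prop
  have h2 : ContDiff ℝ 1 fun x : Space => wavePhase ω l a b k x := by
    unfold wavePhase; fun_prop
  exact (contDiff_bump.comp h1).smul
    ((Complex.ofRealCLM.contDiff.comp h2).mul contDiff_const).cexp

lemma contDiff_vortexLattice : ContDiff ℝ 1 (vortexLattice ω l a b K) :=
  ContDiff.sum fun k _ => contDiff_stripWave k

lemma fderiv_smul_exp {A P : Space → ℝ} {A' P' : Space →L[ℝ] ℝ} {x : Space}
    (hA : HasFDerivAt A A' x) (hP : HasFDerivAt P P' x) (v : Space) :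
    fderiv ℝ (fun x => A x • Complex.exp (P x * Complex.I)) x v
      = (A' v + A x * P' v * Complex.I) * Complex.exp (P x * Complex.I) := by
  have h1 : HasFDerivAt (fun x => (P x : ℂ)) (Complex.ofRealCLM.comp P') x :=
    Complex.ofRealCLM.hasFDerivAt.comp x hP
  have h2 : HasFDerivAt (fun x => A x • Complex.exp (P x * Complex.I)) _ x :=
    hA.smul (h1.mul_const Complex.I).cexp
  rw [h2.fderiv]
  simp
  ring

lemma grad_stripWave (hl : l ≠ 0) (k : ℤ) (j : Fin 3) (x : Space) :
    grad (stripWave ω l a b k) j x =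
      ((![0, -4 * (stripCoord l a x - k) * max (1 - (stripCoord l a x - k) ^ 2) 0
          / (l * Real.pi), 0] j : ℝ)
        + bump (stripCoord l a x - k) *
          (![ω / (2 * l ^ 2) * x 1 - ω / l * (Real.pi * k - a), ω / (2 * l ^ 2) * x 0, 0] j : ℝ)
          * Complex.I) * Complex.exp (wavePhase ω l a b k x * Complex.I) := by
  have h0 (i : Fin 3) : HasFDerivAt (fun x : Space => x i) (EuclideanSpace.proj (𝕜 := ℝ) i) x :=
    (EuclideanSpace.proj (𝕜 := ℝ) i : Space →L[ℝ] ℝ).hasFDerivAt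
  have hS : HasFDerivAt (fun x => stripCoord l a x - k)
      ((1 / (l * Real.pi)) • (EuclideanSpace.proj (𝕜 := ℝ) 1 : Space →L[ℝ] ℝ)) x := by
    refine ((((h0 1).const_mul (1 / (l * Real.pi))).add_const (a / Real.pi - k))
      ).congr_of_eventuallyEq (Eventually.of_forall fun y => ?_)
    simp only [stripCoord]
    have := Real.pi_ne_zero
    field_simp
    ring
  have hP : HasFDerivAt (wavePhase ω l a b k) _ x :=
    (((h0 0).mul (h0 1)).const_mul (ω / (2 * l ^ 2))).sub
      ((h0 0).const_mul (ω / l * (Real.pi * k - a))) |>.sub_const (2 * b * k)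
  have hA := (hasDerivAt_bump (stripCoord l a x - k)).comp_hasFDerivAt x hS
  have := fderiv_smul_exp hA hP (EuclideanSpace.single j 1)
  rw [grad]
  refine this.trans ?_
  congr 1
  fin_cases j
  all_goals simp
  ring

/-- For `ε = l²` the `x 0 * x 1` term of the phase cancels the second component of `A` and turns the
first into `-ω x 1`. The `k`-th momentum cancels that at the centre of the `k`-th strip, leaving a
remainder of order `l`. -/
lemma covDeriv_vortexLattice (hl : 0 < l) (j : Fin 3) (x : Space) :
    covDeriv ω (l ^ 2) (vortexLattice ω l a b K) j x =
      ∑ k ∈ Finset.Icc (-(K : ℤ)) K,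
        ![((-(ω * l * Real.pi * ((stripCoord l a x - k) * bump (stripCoord l a x - k))) : ℝ) : ℂ),
          ((l / Real.pi *
            (-4 * (stripCoord l a x - k) * max (1 - (stripCoord l a x - k) ^ 2) 0) : ℝ) : ℂ)
            * Complex.I, 0] j * Complex.exp (wavePhase ω l a b k x * Complex.I) := by
  have hg : grad (vortexLattice ω l a b K) j x
      = ∑ k ∈ Finset.Icc (-(K : ℤ)) K, grad (stripWave ω l a b k) j x := by
    have : HasFDerivAt (vortexLattice ω l a b K) _ x := HasFDerivAt.fun_sum fun k _ =>
      ((contDiff_stripWave (ω := ω) (l := l) (a := a) (b := b) k).differentiable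
        one_ne_zero x).hasFDerivAt
    rw [grad, this.fderiv]
    simp [grad]
  rw [covDeriv, hg, vortexLattice, Finset.mul_sum, Finset.mul_sum, ← Finset.sum_add_distrib]
  refine Finset.sum_congr rfl fun k _ => ?_
  rw [grad_stripWave hl.ne', stripWave, Complex.real_smul]
  have hx : x 1 = l * (Real.pi * stripCoord l a x - a) := by
    have := Real.pi_ne_zero
    rw [stripCoord]; field_simp; ring
  have hl' : (l : ℂ) ≠ 0 := by exact_mod_cast hl.ne'
  have hπ : (Real.pi : ℂ) ≠ 0 := by exact_mod_cast Real.pi_ne_zero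
  fin_cases j
  · simp [vectorPotential]
    rw [hx]
    push_cast
    field_simp
    ring_nf
    simp
    ring
  · simp [vectorPotential]
    field_simp
    ring_nf
    simp
  · simp [vectorPotential]

lemma sum_norm_covDeriv_vortexLattice_sq_le (hl : 0 < l) (x : Space) :
    ∑ j, ‖covDeriv ω (l ^ 2) (vortexLattice ω l a b K) j x‖ ^ 2
      ≤ (64 * ω ^ 2 + 64) * l ^ 2 := by
  have hπ := Real.pi_pos
  have h0 : ‖covDeriv ω (l ^ 2) (vortexLattice ω l a b K) 0 x‖ ≤ 2 * (|ω| * l * 4) := by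
    rw [covDeriv_vortexLattice hl]
    refine norm_sum_le_two_mul (t := stripCoord l a x) (fun k => ?_) (fun k hk => ?_) _
    · rw [norm_mul, Complex.norm_exp_ofReal_mul_I, mul_one]
      simp only [Matrix.cons_val_zero, norm_neg, Complex.norm_real, Real.norm_eq_abs, abs_mul,
        abs_of_pos hl, abs_of_pos hπ]
      have h1 : |stripCoord l a x - k| * |bump (stripCoord l a x - k)| ≤ 1 := by
        by_cases h : 1 ≤ |stripCoord l a x - k|
        · rw [bump_eq_zero h]; simp
        · rw [abs_of_nonneg (bump_nonneg _)]
          exact mul_le_one₀ (not_le.1 h).le (bump_nonneg _) (bump_le_one _)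
      have h2 : Real.pi * (|stripCoord l a x - k| * |bump (stripCoord l a x - k)|) ≤ 4 * 1 :=
        mul_le_mul Real.pi_le_four h1 (by positivity) (by norm_num)
      have h3 : 0 ≤ |ω| * l := by positivity
      nlinarith [mul_le_mul_of_nonneg_left h2 h3]
    · simp [bump_eq_zero hk]
  have h1 : ‖covDeriv ω (l ^ 2) (vortexLattice ω l a b K) 1 x‖ ≤ 2 * (4 * l) := by
    rw [covDeriv_vortexLattice hl]
    refine norm_sum_le_two_mul (t := stripCoord l a x) (fun k => ?_) (fun k hk => ?_) _
    · rw [norm_mul, Complex.norm_exp_ofReal_mul_I, mul_one]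
      simp only [Matrix.cons_val_one, Matrix.cons_val_zero, norm_mul, Complex.norm_I, mul_one,
        Complex.norm_real, Real.norm_eq_abs, abs_div, abs_of_pos hl, abs_of_pos hπ]
      have hm : 0 ≤ max (1 - (stripCoord l a x - k) ^ 2) 0 := le_max_right _ _
      have h1 : |stripCoord l a x - k| * max (1 - (stripCoord l a x - k) ^ 2) 0 ≤ 1 := by
        by_cases h : 1 ≤ |stripCoord l a x - k|
        · rw [max_one_sub_sq_eq_zero h]; simp
        · exact mul_le_one₀ (not_le.1 h).le hm (max_one_sub_sq_le_one _)
      have h2 : l / Real.pi ≤ l := div_le_self hl.le (by linarith [Real.pi_gt_three])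
      have h3 : 0 ≤ l / Real.pi := by positivity
      rw [abs_of_nonneg hm, show |(-4 : ℝ)| = 4 by norm_num, mul_assoc 4]
      nlinarith [mul_le_mul h2 h1 (by positivity) hl.le]
    · simp only [max_one_sub_sq_eq_zero hk]; simp
  have h2 : covDeriv ω (l ^ 2) (vortexLattice ω l a b K) 2 x = 0 := by
    rw [covDeriv_vortexLattice hl]; simp
  rw [Fin.sum_univ_three, h2, norm_zero]
  have e0 := pow_le_pow_left₀ (norm_nonneg _) h0 2
  have e1 := pow_le_pow_left₀ (norm_nonneg _) h1 2
  have := sq_abs ω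
  nlinarith

/-- The hypothesis ensures that both waves alive at `x`, of indices `⌊t⌋` and `⌊t⌋ + 1`, belong to
the finite sum. Half their phase difference is the argument of the second cosine. -/
lemma norm_sq_vortexLattice_ge {x : Space} (h : |stripCoord l a x| + 1 ≤ K) :
    1 / 8 * (Real.cos (x 1 / l + a) ^ 2 + Real.cos (Real.pi * ω / (2 * l) * x 0 + b) ^ 2)
      ≤ ‖vortexLattice ω l a b K x‖ ^ 2 := by
  set t := stripCoord l a x with ht
  obtain ⟨h1, h2⟩ := abs_le.1 (show |t| ≤ K - 1 by linarith)
  have hfl := Int.floor_le t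
  have hfl' := Int.lt_floor_add_one t
  have hn1 : -(K : ℤ) ≤ ⌊t⌋ := by
    rw [Int.le_floor]; push_cast; linarith
  have hn2 : ⌊t⌋ + 1 ≤ K := by
    have : (⌊t⌋ : ℝ) + 1 ≤ K := by linarith
    exact_mod_cast this
  have hF : vortexLattice ω l a b K x
      = stripWave ω l a b ⌊t⌋ x + stripWave ω l a b (⌊t⌋ + 1) x := by
    refine Eq.trans (Finset.sum_subset (fun k hk => ?_) fun k _ hk => ?_).symm
      (Finset.sum_pair (f := fun k => stripWave ω l a b k x) (by omega : ⌊t⌋ ≠ ⌊t⌋ + 1))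
    · simp only [Finset.mem_insert, Finset.mem_singleton] at hk
      rw [Finset.mem_Icc]; omega
    · rw [stripWave, bump_eq_zero, zero_smul]
      by_contra! hlt
      exact hk (by simpa using eq_floor_or_eq_of_abs_sub_lt hlt)
  have hphase : (wavePhase ω l a b ⌊t⌋ x - wavePhase ω l a b (⌊t⌋ + 1) x) / 2
      = Real.pi * ω / (2 * l) * x 0 + b := by
    simp only [wavePhase]; push_cast; ring
  rw [hF, stripWave, stripWave, norm_sq_add_mul_exp, hphase, ← ht, Int.self_sub_floor]
  have e1 : t - ((⌊t⌋ + 1 : ℤ) : ℝ) = Int.fract t - 1 := by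
    rw [← Int.self_sub_floor]; push_cast; ring
  have e2 : x 1 / l + a = Real.pi * t := by
    have := Real.pi_ne_zero
    rw [ht, stripCoord]; field_simp
  rw [e1, e2]
  refine le_trans ?_ (bump_interpolation_lower_bound (Int.fract_nonneg t) (Int.fract_lt_one t).le
    (sq_nonneg _) (Real.cos_sq_le_one _))
  linarith [cos_pi_mul_sq_le t]

end lattice

/-! ### Averaging over translations of the lattice. -/

lemma integral_cos_sq_shift (φ : ℝ → ℝ) (u : ℝ) :
    ∫ a in (0 : ℝ)..Real.pi, φ (Real.cos (u + a) ^ 2)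
      = ∫ a in (-(Real.pi / 2))..(Real.pi / 2), φ (Real.sin a ^ 2) := by
  have hper : Function.Periodic (fun c => φ (Real.cos c ^ 2)) Real.pi := fun c => by
    simp [Real.cos_add_pi]
  have h1 := intervalIntegral.integral_comp_add_left (a := 0) (b := Real.pi)
    (fun c => φ (Real.cos c ^ 2)) u
  have h2 := intervalIntegral.integral_comp_add_left (a := -(Real.pi / 2)) (b := Real.pi / 2)
    (fun c => φ (Real.cos c ^ 2)) (Real.pi / 2)
  rw [h1, add_zero, hper.intervalIntegral_add_eq u 0]
  simp only [add_comm (Real.pi / 2), Real.cos_add_pi_div_two, neg_sq] at h2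
  rw [h2]
  congr 1 <;> ring

lemma abs_div_two_le_abs_sin {a : ℝ} (ha : |a| ≤ Real.pi / 2) : |a| / 2 ≤ |Real.sin a| := by
  refine le_trans ?_ (Real.mul_abs_le_abs_sin ha)
  rw [div_eq_inv_mul]
  gcongr
  rw [inv_eq_one_div, div_le_div_iff₀ two_pos Real.pi_pos]
  linarith [Real.pi_le_four]

/-- Comparing `sin² a` with `(a / 2)²` leaves an arctangent integral. Integrating its bound in the
other variable produces the logarithm. -/
lemma integral_inv_add_sin_sq_le {A : ℝ} (hA : 0 < A) :
    ∫ a in (-(Real.pi / 2))..(Real.pi / 2), (A + Real.sin a ^ 2)⁻¹ ≤ 2 * Real.pi / √A := by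
  have hπ := Real.pi_pos
  have hs : 0 < √A := Real.sqrt_pos.2 hA
  have hs2 : √A ^ 2 = A := Real.sq_sqrt hA.le
  have hd (a : ℝ) : HasDerivAt (fun a => 2 / √A * Real.arctan (a / (2 * √A)))
      ((A + (a / 2) ^ 2)⁻¹) a := by
    have h := (((hasDerivAt_id a).div_const (2 * √A)).arctan).const_mul (2 / √A)
    refine h.congr_deriv ?_
    simp only [id]
    rw [show A + (a / 2) ^ 2 = √A ^ 2 + (a / 2) ^ 2 by rw [hs2]]
    have : √A ^ 2 + (a / 2) ^ 2 ≠ 0 := by positivity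
    field_simp
  have hcont : Continuous fun a : ℝ => (A + (a / 2) ^ 2)⁻¹ :=
    Continuous.inv₀ (by fun_prop) fun a => by positivity
  have hcont' : Continuous fun a : ℝ => (A + Real.sin a ^ 2)⁻¹ :=
    Continuous.inv₀ (by fun_prop) fun a => by positivity
  calc _ ≤ ∫ a in (-(Real.pi / 2))..(Real.pi / 2), (A + (a / 2) ^ 2)⁻¹ := by
        refine intervalIntegral.integral_mono_on (by linarith) (hcont'.intervalIntegrable _ _)
          (hcont.intervalIntegrable _ _) fun a ha => ?_
        have h := abs_div_two_le_abs_sin (abs_le.2 ha)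
        have h2 : (a / 2) ^ 2 ≤ Real.sin a ^ 2 := by
          rw [sq_le_sq, abs_div, abs_two]; exact h
        gcongr
    _ = 2 / √A * Real.arctan ((Real.pi / 2) / (2 * √A))
          - 2 / √A * Real.arctan (-(Real.pi / 2) / (2 * √A)) :=
        intervalIntegral.integral_eq_sub_of_hasDerivAt (fun a _ => hd a)
          (hcont.intervalIntegrable _ _)
    _ ≤ 2 / √A * (Real.pi / 2) - 2 / √A * (-(Real.pi / 2)) := by
        have h1 := (Real.arctan_lt_pi_div_two ((Real.pi / 2) / (2 * √A))).le
        have h2 := (Real.neg_pi_div_two_lt_arctan (-(Real.pi / 2) / (2 * √A))).le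
        gcongr
    _ = 2 * Real.pi / √A := by ring

lemma integral_inv_sqrt_add_sin_sq_le {δ : ℝ} (h0 : 0 < δ) (h1 : δ ≤ 1) :
    ∫ a in (-(Real.pi / 2))..(Real.pi / 2), 2 * Real.pi / √(δ ^ 2 + Real.sin a ^ 2)
      ≤ 16 * Real.pi * Real.log (2 / δ) := by
  have hπ := Real.pi_pos
  have hpt (a : ℝ) (ha : |a| ≤ Real.pi / 2) : 2 * Real.pi / √(δ ^ 2 + Real.sin a ^ 2)
      ≤ 4 * Real.pi * (δ + |a| / 2)⁻¹ := by
    have h := abs_div_two_le_abs_sin ha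
    have h2 : (δ + |a| / 2) / 2 ≤ √(δ ^ 2 + Real.sin a ^ 2) := by
      refine Real.le_sqrt_of_sq_le ?_
      have := sq_abs (Real.sin a)
      nlinarith [sq_nonneg (δ - |Real.sin a|), abs_nonneg a, abs_nonneg (Real.sin a)]
    calc _ ≤ 2 * Real.pi / ((δ + |a| / 2) / 2) := by gcongr
      _ = _ := by field_simp; ring
  have hcont : Continuous fun a : ℝ => 4 * Real.pi * (δ + |a| / 2)⁻¹ :=
    continuous_const.mul (Continuous.inv₀ (by fun_prop) fun a => by positivity)
  have hcont' : Continuous fun a : ℝ => 2 * Real.pi / √(δ ^ 2 + Real.sin a ^ 2) :=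
    Continuous.div continuous_const (by fun_prop) fun a => by positivity
  have hpos : ∫ a in (0 : ℝ)..(Real.pi / 2), 4 * Real.pi * (δ + |a| / 2)⁻¹
      ≤ 8 * Real.pi * Real.log (2 / δ) := by
    have hd (a : ℝ) (ha : 0 ≤ a) : HasDerivAt (fun a => 8 * Real.pi * Real.log (δ + a / 2))
        (4 * Real.pi * (δ + |a| / 2)⁻¹) a := by
      have h := ((((hasDerivAt_id a).div_const 2).const_add δ).log
        (by simp only [id]; positivity)).const_mul (8 * Real.pi)
      refine h.congr_deriv ?_
      rw [abs_of_nonneg ha]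
      simp only [id]
      field_simp
      ring
    rw [intervalIntegral.integral_eq_sub_of_hasDerivAt (fun a ha => hd a (by
      rw [Set.uIcc_of_le (by positivity)] at ha; exact ha.1)) (hcont.intervalIntegrable _ _)]
    rw [← mul_sub, zero_div, add_zero, ← Real.log_div (by positivity) h0.ne']
    gcongr
    linarith [Real.pi_le_four]
  have hneg : ∫ a in (-(Real.pi / 2))..(0 : ℝ), 4 * Real.pi * (δ + |a| / 2)⁻¹
      = ∫ a in (0 : ℝ)..(Real.pi / 2), 4 * Real.pi * (δ + |a| / 2)⁻¹ := by
    have := intervalIntegral.integral_comp_neg (a := 0) (b := Real.pi / 2)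
      fun a : ℝ => 4 * Real.pi * (δ + |a| / 2)⁻¹
    simp only [abs_neg, neg_zero] at this
    exact this.symm
  calc _ ≤ ∫ a in (-(Real.pi / 2))..(Real.pi / 2), 4 * Real.pi * (δ + |a| / 2)⁻¹ :=
        intervalIntegral.integral_mono_on (by linarith) (hcont'.intervalIntegrable _ _)
          (hcont.intervalIntegrable _ _) fun a ha => hpt a (abs_le.2 ha)
    _ = _ := (intervalIntegral.integral_add_adjacent_intervals (b := 0)
        (hcont.intervalIntegrable _ _) (hcont.intervalIntegrable _ _)).symm
    _ ≤ _ := by rw [hneg]; linarith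

/-- The singular weight controlling the vortex cores. -/
noncomputable def coreWeight (δ u v : ℝ) (p : ℝ × ℝ) : ℝ :=
  (δ ^ 2 + Real.cos (u + p.1) ^ 2 + Real.cos (v + p.2) ^ 2)⁻¹

lemma coreWeight_pos {δ : ℝ} (h0 : 0 < δ) (u v : ℝ) (p : ℝ × ℝ) : 0 < coreWeight δ u v p := by
  unfold coreWeight; positivity

lemma coreWeight_le {δ : ℝ} (h0 : 0 < δ) (u v : ℝ) (p : ℝ × ℝ) :
    coreWeight δ u v p ≤ (δ ^ 2)⁻¹ := by
  unfold coreWeight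
  gcongr
  nlinarith [sq_nonneg (Real.cos (u + p.1)), sq_nonneg (Real.cos (v + p.2))]

lemma continuous_coreWeight {X : Type*} [TopologicalSpace X] {δ : ℝ} (h0 : 0 < δ)
    {u v : X → ℝ} {p : X → ℝ × ℝ} (hu : Continuous u) (hv : Continuous v) (hp : Continuous p) :
    Continuous fun x => coreWeight δ (u x) (v x) (p x) := by
  unfold coreWeight
  exact Continuous.inv₀ (by fun_prop) fun a => by positivity

/-- Lebesgue measure on a period cell of the lattice parameters. -/
noncomputable def cellMeasure : Measure (ℝ × ℝ) :=
  (volume.restrict (Set.Ioc 0 Real.pi)).prod (volume.restrict (Set.Ioc 0 Real.pi))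

instance : IsFiniteMeasure cellMeasure := by unfold cellMeasure; infer_instance

lemma cellMeasure_univ : cellMeasure Set.univ = ENNReal.ofReal (Real.pi ^ 2) := by
  rw [cellMeasure, ← Set.univ_prod_univ, Measure.prod_prod, Measure.restrict_apply_univ,
    Real.volume_Ioc, sub_zero, ← ENNReal.ofReal_mul Real.pi_pos.le, sq]

lemma integrable_coreWeight {δ : ℝ} (h0 : 0 < δ) (u v : ℝ) :
    Integrable (coreWeight δ u v) cellMeasure := by
  refine Integrable.of_bound
    (continuous_coreWeight h0 continuous_const continuous_const
      continuous_id).aestronglyMeasurable (δ ^ 2)⁻¹ (Eventually.of_forall fun p => ?_)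
  rw [Real.norm_of_nonneg (coreWeight_pos h0 _ _ _).le]
  exact coreWeight_le h0 _ _ _

lemma integral_coreWeight_le {δ : ℝ} (h0 : 0 < δ) (h1 : δ ≤ 1) (u v : ℝ) :
    ∫ p, coreWeight δ u v p ∂cellMeasure ≤ 16 * Real.pi * Real.log (2 / δ) := by
  have hπ := Real.pi_pos
  have hint := integrable_coreWeight h0 u v
  rw [cellMeasure] at hint ⊢
  rw [integral_prod _ hint, ← intervalIntegral.integral_of_le hπ.le]
  have hcont : Continuous fun a : ℝ => 2 * Real.pi / √(δ ^ 2 + Real.cos (u + a) ^ 2) :=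
    Continuous.div continuous_const (by fun_prop) fun a => by positivity
  refine le_trans (b := ∫ a in (0 : ℝ)..Real.pi, 2 * Real.pi / √(δ ^ 2 + Real.cos (u + a) ^ 2))
    ?_ ?_
  · refine intervalIntegral.integral_mono_on hπ.le ?_ (hcont.intervalIntegrable _ _)
      fun a _ => ?_
    · rw [intervalIntegrable_iff_integrableOn_Ioc_of_le hπ.le]
      exact hint.integral_prod_left
    · rw [← intervalIntegral.integral_of_le hπ.le]
      simp only [coreWeight]
      rw [integral_cos_sq_shift fun y => (δ ^ 2 + Real.cos (u + a) ^ 2 + y)⁻¹]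
      exact integral_inv_add_sin_sq_le (by positivity)
  · rw [integral_cos_sq_shift fun y => 2 * Real.pi / √(δ ^ 2 + y)]
    exact integral_inv_sqrt_add_sin_sq_le h0 h1

/-- By Fubini the mean over the cell of the weighted integral obeys the bound, since the inner
integral does so uniformly in `u` and `v`; some translation does no worse than the mean. Only the
shifts are averaged, so `u` or `v` may be constant, as happens for `ω = 0`. -/
lemma exists_integral_mul_coreWeight_le {X : Type*} [MeasurableSpace X] [TopologicalSpace X]
    [BorelSpace X] [SecondCountableTopology X] {m : Measure X} [SFinite m] {h u v : X → ℝ}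
    (hh : Integrable h m) (hnn : ∀ x, 0 ≤ h x) (h1 : ∫ x, h x ∂m ≤ 1) (hu : Continuous u)
    (hv : Continuous v) {δ : ℝ} (hδ0 : 0 < δ) (hδ1 : δ ≤ 1) :
    ∃ p : ℝ × ℝ, ∫ x, h x * coreWeight δ (u x) (v x) p ∂m ≤ 16 * Real.log (2 / δ) := by
  have hπ := Real.pi_pos
  have hlog : 0 ≤ Real.log (2 / δ) := Real.log_nonneg (by rw [le_div_iff₀ hδ0]; linarith)
  have hint : Integrable (fun z : X × (ℝ × ℝ) => h z.1 * coreWeight δ (u z.1) (v z.1) z.2)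
      (m.prod cellMeasure) := by
    have hc : Continuous fun z : X × (ℝ × ℝ) => coreWeight δ (u z.1) (v z.1) z.2 :=
      continuous_coreWeight hδ0 (hu.comp continuous_fst) (hv.comp continuous_fst) continuous_snd
    refine (hh.comp_fst cellMeasure).mul_bdd (c := (δ ^ 2)⁻¹) hc.aestronglyMeasurable
      (Eventually.of_forall fun z => ?_)
    rw [Real.norm_of_nonneg (coreWeight_pos hδ0 _ _ _).le]
    exact coreWeight_le hδ0 _ _ _
  have hne : cellMeasure ≠ 0 := by
    intro h
    have := cellMeasure_univ
    rw [h] at this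
    simp [hπ.ne'] at this
  obtain ⟨p, hp⟩ := exists_le_average hne hint.integral_prod_right
  refine ⟨p, hp.trans ?_⟩
  rw [average_eq, ← integral_integral_swap hint, measureReal_def, cellMeasure_univ,
    ENNReal.toReal_ofReal (by positivity), smul_eq_mul, inv_mul_le_iff₀ (by positivity)]
  calc ∫ x, ∫ p, h x * coreWeight δ (u x) (v x) p ∂cellMeasure ∂m
      ≤ ∫ x, h x * (16 * Real.pi * Real.log (2 / δ)) ∂m := by
        refine integral_mono hint.integral_prod_left (hh.mul_const _) fun x => ?_
        simp only [integral_const_mul]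
        exact mul_le_mul_of_nonneg_left (integral_coreWeight_le hδ0 hδ1 _ _) (hnn x)
    _ = (∫ x, h x ∂m) * (16 * Real.pi * Real.log (2 / δ)) := integral_mul_const _ _
    _ ≤ 1 * (16 * Real.pi * Real.log (2 / δ)) := by gcongr
    _ ≤ Real.pi ^ 2 * (16 * Real.log (2 / δ)) := by
        have : 0 ≤ (Real.pi - 1) * (Real.pi * (16 * Real.log (2 / δ))) := by
          have := Real.pi_gt_three
          exact mul_nonneg (by linarith) (by positivity)
        nlinarith

/-! ### Flattening the modulus of the lattice. -/

/-- `F` with its modulus regularized to be of order one away from the zeros, times `f`. -/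
noncomputable def modulate (δ : ℝ) (f : Space → ℝ) (F : Space → ℂ) (x : Space) : ℂ :=
  (f x / √(‖F x‖ ^ 2 + δ ^ 2)) • F x

section modulate

variable {δ : ℝ} {f : Space → ℝ} {F : Space → ℂ}

lemma contDiff_modulate (hδ : 0 < δ) (hf : ContDiff ℝ 1 f) (hF : ContDiff ℝ 1 F) :
    ContDiff ℝ 1 (modulate δ f F) := by
  have h1 : ContDiff ℝ 1 fun x => √(‖F x‖ ^ 2 + δ ^ 2) :=
    ((hF.norm_sq ℝ).add contDiff_const).sqrt fun x => by positivity
  exact (hf.div h1 fun x => by positivity).smul hF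

lemma hasCompactSupport_modulate (hf : HasCompactSupport f) :
    HasCompactSupport (modulate δ f F) := by
  refine hf.mono fun x hx => ?_
  contrapose! hx
  simp [modulate, Function.notMem_support.1 hx]

lemma norm_sq_modulate (hδ : 0 < δ) (x : Space) :
    ‖modulate δ f F x‖ ^ 2 = f x ^ 2 - δ ^ 2 * (f x ^ 2 / (‖F x‖ ^ 2 + δ ^ 2)) := by
  have h : 0 < ‖F x‖ ^ 2 + δ ^ 2 := by positivity
  rw [modulate, norm_smul, mul_pow, Real.norm_eq_abs, sq_abs, div_pow, Real.sq_sqrt h.le]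
  field_simp
  ring

/-- Diamagnetic argument: differentiating `1/N` involves only `Re (∂F · conj F)`. As `A` is real,
`ε` times this is `Im (D · conj F)`, so the covariant derivative `D` controls it too; hence the
factor `2`. -/
lemma norm_covDeriv_modulate_le {ω ε : ℝ} (hε : 0 < ε) (hδ : 0 < δ) (hf : ContDiff ℝ 1 f)
    (hF : ContDiff ℝ 1 F) (j : Fin 3) (x : Space) :
    ‖covDeriv ω ε (modulate δ f F) j x‖ ≤ ε * |fderiv ℝ f x (EuclideanSpace.single j 1)|
      + 2 * (|f x| * ‖covDeriv ω ε F j x‖ / √(‖F x‖ ^ 2 + δ ^ 2)) := by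
  have hN2 : 0 < ‖F x‖ ^ 2 + δ ^ 2 := by positivity
  set N := √(‖F x‖ ^ 2 + δ ^ 2) with hN
  have hN0 : 0 < N := Real.sqrt_pos.2 hN2
  have hFN : ‖F x‖ ≤ N := Real.le_sqrt_of_sq_le (by nlinarith [sq_nonneg δ])
  have hf' := (hf.differentiable one_ne_zero x).hasFDerivAt
  have hF' := (hF.differentiable one_ne_zero x).hasFDerivAt
  have hNd : HasFDerivAt (fun x => √(‖F x‖ ^ 2 + δ ^ 2)) _ x :=
    (hF'.norm_sq.add_const (δ ^ 2)).sqrt hN2.ne'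
  have hinv : HasFDerivAt (fun x => (√(‖F x‖ ^ 2 + δ ^ 2))⁻¹) _ x :=
    (hasDerivAt_inv hN0.ne').comp_hasFDerivAt x hNd
  have hmod : modulate δ f F = fun x => (f x * (√(‖F x‖ ^ 2 + δ ^ 2))⁻¹) • F x := by
    funext x; rw [modulate, div_eq_mul_inv]
  have hΦ : HasFDerivAt (fun x => (f x * (√(‖F x‖ ^ 2 + δ ^ 2))⁻¹) • F x) _ x :=
    (hf'.mul hinv).smul hF'
  set v : Space := EuclideanSpace.single j 1
  set D := covDeriv ω ε F j x with hD
  set n := (fderiv ℝ F x v * star (F x)).re / N with hn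
  have hgrad : grad (modulate δ f F) j x
      = (f x / N) • grad F j x
        + ((fderiv ℝ f x v / N - f x * n / N ^ 2) : ℝ) • F x := by
    rw [grad, hmod, hΦ.fderiv]
    simp [grad, ← hN, v, hn, Complex.inner]
    field_simp
    ring
  have hεn : |ε * n| ≤ ‖D‖ := by
    have e : (D * star (F x)).im = ε * (fderiv ℝ F x v * star (F x)).re := by
      simp [hD, covDeriv, grad, v]
      ring
    have e2 : ε * n = (D * star (F x)).im / N := by rw [e, hn]; ring
    rw [e2, abs_div, abs_of_pos hN0, div_le_iff₀ hN0]
    refine (Complex.abs_im_le_norm _).trans ?_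
    rw [norm_mul, norm_star]
    gcongr
  have hcov : covDeriv ω ε (modulate δ f F) j x
      = (f x / N) • D + (ε * (fderiv ℝ f x v / N - f x * n / N ^ 2)) • (Complex.I * F x) := by
    rw [covDeriv, hgrad, hD, covDeriv, modulate, ← hN]
    simp only [Complex.real_smul]
    push_cast
    ring
  have h1 : ‖(f x / N) • D‖ = |f x| * ‖D‖ / N := by
    rw [norm_smul, Real.norm_eq_abs, abs_div, abs_of_pos hN0]; ring
  have h2 : ‖(ε * (fderiv ℝ f x v / N - f x * n / N ^ 2)) • (Complex.I * F x)‖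
      ≤ ε * |fderiv ℝ f x v| + |f x| * ‖D‖ / N := by
    rw [norm_smul, norm_mul Complex.I, Complex.norm_I, one_mul, Real.norm_eq_abs]
    have e : ε * (fderiv ℝ f x v / N - f x * n / N ^ 2)
        = (ε * fderiv ℝ f x v - f x * (ε * n) / N) / N := by field_simp
    rw [e, abs_div, abs_of_pos hN0, div_mul_eq_mul_div, div_le_iff₀ hN0]
    have h3 : |ε * fderiv ℝ f x v - f x * (ε * n) / N|
        ≤ ε * |fderiv ℝ f x v| + |f x| * ‖D‖ / N := by
      refine (abs_sub _ _).trans ?_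
      rw [abs_mul, abs_of_pos hε, abs_div, abs_of_pos hN0, abs_mul]
      gcongr
    gcongr
  rw [hcov]
  refine (norm_add_le _ _).trans ?_
  rw [h1]
  linarith

end modulate

/-! ### Normalizing a trial state. -/

section normalize

variable {V : Space → ℝ} {ω ε : ℝ}

lemma continuous_covDeriv {Φ : Space → ℂ} (hΦ : ContDiff ℝ 1 Φ) (j : Fin 3) :
    Continuous (covDeriv ω ε Φ j) := by
  have hA := continuous_vectorPotential ω j
  have hg := continuous_grad hΦ j
  have h0 := hΦ.continuous
  unfold covDeriv
  fun_prop

lemma integrable_sum_norm_covDeriv_sq {Φ : Space → ℂ} (hΦ : ContDiff ℝ 1 Φ)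
    (hc : HasCompactSupport Φ) : Integrable fun x => ∑ j, ‖covDeriv ω ε Φ j x‖ ^ 2 := by
  refine integrable_finsetSum _ fun j _ => ?_
  have := continuous_covDeriv (ω := ω) (ε := ε) hΦ j
  refine Continuous.integrable_of_hasCompactSupport (by fun_prop) ?_
  have h : HasCompactSupport (covDeriv ω ε Φ j) :=
    HasCompactSupport.add (hasCompactSupport_grad hc j).mul_left hc.mul_left
  exact h.comp_left (g := fun z : ℂ => ‖z‖ ^ 2) (by simp)

lemma covDeriv_smul {Φ : Space → ℂ} (hΦ : ContDiff ℝ 1 Φ) (c : ℝ) (j : Fin 3) (x : Space) :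
    covDeriv ω ε (c • Φ) j x = c • covDeriv ω ε Φ j x := by
  have h := ((hΦ.differentiable one_ne_zero x).hasFDerivAt.const_smul c).fderiv
  simp only [covDeriv, grad, h, _root_.smul_apply, Pi.smul_apply, Complex.real_smul]
  ring

lemma scaledFunctional_smul (hW : Continuous (effPotential V ω)) {Φ : Space → ℂ}
    (hΦ : ContDiff ℝ 1 Φ) (hc : HasCompactSupport Φ) (c : ℝ) :
    scaledFunctional V ω ε (c • Φ) = c ^ 2 * ((∫ x, ∑ j, ‖covDeriv ω ε Φ j x‖ ^ 2)
      + ∫ x, effPotential V ω x * ‖Φ x‖ ^ 2) + c ^ 4 * ∫ x, ‖Φ x‖ ^ 4 := by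
  have h0 := hΦ.continuous
  have i1 := integrable_sum_norm_covDeriv_sq (ω := ω) (ε := ε) hΦ hc
  have i2 : Integrable fun x => effPotential V ω x * ‖Φ x‖ ^ 2 :=
    Continuous.integrable_of_hasCompactSupport (by fun_prop)
      (HasCompactSupport.mul_left (hc.comp_left (g := fun z : ℂ => ‖z‖ ^ 2) (by simp)))
  have i4 : Integrable fun x => ‖Φ x‖ ^ 4 :=
    Continuous.integrable_of_hasCompactSupport (by fun_prop)
      (hc.comp_left (g := fun z : ℂ => ‖z‖ ^ 4) (by simp))
  rw [← integral_add i1 i2, ← integral_const_mul, ← integral_const_mul,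
    ← integral_add (by exact (i1.add i2).const_mul _) (i4.const_mul _), scaledFunctional]
  refine integral_congr_ae (Eventually.of_forall fun x => ?_)
  simp only [covDeriv_smul hΦ, norm_smul, mul_pow, Real.norm_eq_abs, sq_abs, Pi.smul_apply,
    ← Finset.mul_sum]
  rw [show |c| ^ 4 = c ^ 4 by rw [show (4 : ℕ) = 2 * 2 by norm_num, pow_mul, sq_abs, ← pow_mul]]
  ring

lemma exists_normalized (hW : Continuous (effPotential V ω)) {Φ : Space → ℂ}
    (hΦ : ContDiff ℝ 1 Φ) (hc : HasCompactSupport Φ) {m : ℝ} (hm : 0 < m)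
    (hΦm : ∫ x, ‖Φ x‖ ^ 2 = m) :
    ∃ Ψ : Space → ℂ, ContDiff ℝ 1 Ψ ∧ HasCompactSupport Ψ ∧ ∫ x, ‖Ψ x‖ ^ 2 = 1 ∧
      scaledFunctional V ω ε Ψ = m⁻¹ * ((∫ x, ∑ j, ‖covDeriv ω ε Φ j x‖ ^ 2)
        + ∫ x, effPotential V ω x * ‖Φ x‖ ^ 2) + (m⁻¹) ^ 2 * ∫ x, ‖Φ x‖ ^ 4 := by
  have hs : (√m)⁻¹ ^ 2 = m⁻¹ := by rw [inv_pow, Real.sq_sqrt hm.le]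
  refine ⟨(√m)⁻¹ • Φ, contDiff_const.smul hΦ, hc.smul_left (f := fun _ => (√m)⁻¹), ?_, ?_⟩
  · simp only [Pi.smul_apply, norm_smul, mul_pow, Real.norm_eq_abs, sq_abs, hs,
      integral_const_mul, hΦm]
    exact inv_mul_cancel₀ hm.ne'
  · rw [scaledFunctional_smul hW hΦ hc, show (√m)⁻¹ ^ 4 = ((√m)⁻¹ ^ 2) ^ 2 by ring, hs]

/-- Bookkeeping for a mass defect `e ≤ 1/2`: then `m⁻¹ ≤ 1 + 2e` and `m⁻² ≤ 1 + 8e`. -/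
lemma normalized_energy_le {m T P Q S B e : ℝ} (hm1 : m ≤ 1) (hm2 : 1 - e ≤ m) (he : e ≤ 1 / 2)
    (hT0 : 0 ≤ T) (hB : 0 ≤ B) (hP : |P| ≤ B) (hQ0 : 0 ≤ Q) (hQ : Q ≤ S) :
    m⁻¹ * (T + P) + (m⁻¹) ^ 2 * Q ≤ 2 * T + P + Q + (2 * B + 8 * S) * e := by
  have hm : 0 < m := by linarith
  have he0 : 0 ≤ e := by linarith
  obtain ⟨i, hi⟩ : ∃ i, m⁻¹ = i := ⟨_, rfl⟩
  have him : i * m = 1 := by rw [← hi]; exact inv_mul_cancel₀ hm.ne'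
  have hi0 : 0 < i := by rw [← hi]; positivity
  have hi2 : i ≤ 2 := by nlinarith
  have h1 : i - 1 ≤ 2 * e := by nlinarith
  have h1' : 0 ≤ i - 1 := by nlinarith
  have h2 : i ^ 2 - 1 ≤ 8 * e := by nlinarith
  rw [hi]
  have a1 : i * T ≤ 2 * T := by gcongr
  have a2 : (i - 1) * P ≤ 2 * e * B :=
    (mul_le_mul_of_nonneg_left ((le_abs_self P).trans hP) h1').trans (by gcongr)
  have a3 : (i ^ 2 - 1) * Q ≤ 8 * e * S :=
    (mul_le_mul_of_nonneg_right h2 hQ0).trans (by gcongr)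
  nlinarith

end normalize

lemma log_two_div_le {l : ℝ} (h0 : 0 < l) (h1 : l ≤ 1 / 2) :
    Real.log (2 / l) ≤ 2 * Real.log (1 / l) ∧ 1 ≤ 2 * Real.log (1 / l) := by
  have h2 : Real.log 2 ≤ Real.log (1 / l) :=
    Real.log_le_log two_pos (by rw [le_div_iff₀ h0]; linarith)
  have h3 : Real.log (2 / l) = Real.log 2 + Real.log (1 / l) := by
    rw [← Real.log_mul two_ne_zero (by positivity), mul_one_div]
  have := Real.log_two_gt_d9
  constructor <;> linarith

lemma hasCompactSupport_of_imp {E E' : Type*} [Zero E] [Zero E'] {f : Space → E}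
    {g : Space → E'} (hf : HasCompactSupport f) (h : ∀ x, f x = 0 → g x = 0) :
    HasCompactSupport g :=
  hf.mono fun x hx hfx => hx (h x hfx)

/-! ### The trial state and its energy. -/

section trial

variable {V : Space → ℝ} {ω μ : ℝ}

lemma exists_vortexLattice {f : Space → ℝ} (hf : Continuous f) (hfc : HasCompactSupport f)
    (h1 : ∫ x, f x ^ 2 ≤ 1) (ω : ℝ) {l : ℝ} (hl0 : 0 < l) (hl1 : l ≤ 1) :
    ∃ (a b : ℝ) (K : ℕ), ∫ x, f x ^ 2 / (‖vortexLattice ω l a b K x‖ ^ 2 + l ^ 2)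
      ≤ 128 * Real.log (2 / l) := by
  have hf2 : Integrable fun x => f x ^ 2 :=
    Continuous.integrable_of_hasCompactSupport (by fun_prop)
      (hfc.comp_left (g := fun t : ℝ => t ^ 2) (by simp))
  obtain ⟨⟨a, b⟩, hp⟩ := exists_integral_mul_coreWeight_le hf2 (fun x => sq_nonneg (f x)) h1
    (u := fun x : Space => x 1 / l) (v := fun x : Space => Real.pi * ω / (2 * l) * x 0)
    (by fun_prop) (by fun_prop) hl0 hl1
  obtain ⟨M, hM⟩ := hfc.isCompact.exists_bound_of_continuousOn (f := stripCoord l a)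
    (Continuous.continuousOn (by unfold stripCoord; fun_prop))
  -- Enough waves to cover the support of `f`, on which the strip coordinate is at most `M` in
  -- modulus.
  refine ⟨a, b, ⌈M + 1⌉₊, ?_⟩
  have hc : Continuous fun x : Space =>
      coreWeight l (x 1 / l) (Real.pi * ω / (2 * l) * x 0) (a, b) :=
    continuous_coreWeight hl0 (by fun_prop) (by fun_prop) continuous_const
  have hint : Integrable fun x : Space =>
      f x ^ 2 * coreWeight l (x 1 / l) (Real.pi * ω / (2 * l) * x 0) (a, b) :=
    Continuous.integrable_of_hasCompactSupport (by fun_prop)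
      (hasCompactSupport_of_imp hfc fun x hx => by simp [hx])
  calc _ ≤ ∫ x : Space, 8 * (f x ^ 2 *
        coreWeight l (x 1 / l) (Real.pi * ω / (2 * l) * x 0) (a, b)) := by
        refine integral_mono_of_nonneg (Eventually.of_forall fun x => by positivity)
          (hint.const_mul 8) (Eventually.of_forall fun x => ?_)
        by_cases hx : f x = 0
        · simp [hx]
        have hK : |stripCoord l a x| + 1 ≤ (⌈M + 1⌉₊ : ℝ) := by
          refine le_trans ?_ (Nat.le_ceil _)
          have := hM x (subset_tsupport f hx)
          rw [Real.norm_eq_abs] at this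
          linarith
        have hF := norm_sq_vortexLattice_ge (ω := ω) (b := b) hK
        simp only [coreWeight]
        rw [div_eq_mul_inv, mul_left_comm]
        have hl2 : 0 < l ^ 2 := by positivity
        gcongr
        rw [inv_le_comm₀ (by positivity) (by positivity), mul_inv, inv_inv]
        linarith
    _ = 8 * ∫ x : Space, f x ^ 2 *
        coreWeight l (x 1 / l) (Real.pi * ω / (2 * l) * x 0) (a, b) := integral_const_mul _ _
    _ ≤ 8 * (16 * Real.log (2 / l)) := by gcongr
    _ = _ := by ring

lemma integral_sum_norm_covDeriv_modulate_sq_le {f : Space → ℝ} {F : Space → ℂ} {ε δ D : ℝ}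
    (hε : 0 < ε) (hδ : 0 < δ) (hf : ContDiff ℝ 1 f) (hfc : HasCompactSupport f)
    (hF : ContDiff ℝ 1 F) (hD : ∀ x, ∑ j, ‖covDeriv ω ε F j x‖ ^ 2 ≤ D) :
    ∫ x, ∑ j, ‖covDeriv ω ε (modulate δ f F) j x‖ ^ 2
      ≤ 2 * ε ^ 2 * (∫ x, ∑ j, fderiv ℝ f x (EuclideanSpace.single j 1) ^ 2)
        + 8 * D * ∫ x, f x ^ 2 / (‖F x‖ ^ 2 + δ ^ 2) := by
  have hdc (j : Fin 3) : Continuous fun x => fderiv ℝ f x (EuclideanSpace.single j 1) :=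
    (hf.continuous_fderiv one_ne_zero).clm_apply continuous_const
  have i1 : Integrable fun x => ∑ j, fderiv ℝ f x (EuclideanSpace.single j 1) ^ 2 :=
    Continuous.integrable_of_hasCompactSupport (by fun_prop)
      (hasCompactSupport_of_imp (hfc.fderiv ℝ) fun x hx => by simp [hx])
  have hfc0 := hf.continuous
  have hFc0 := hF.continuous
  have i2 : Integrable fun x => f x ^ 2 / (‖F x‖ ^ 2 + δ ^ 2) := by
    refine Continuous.integrable_of_hasCompactSupport
      (Continuous.div (by fun_prop) (by fun_prop) fun x => by positivity) ?_
    exact hasCompactSupport_of_imp hfc fun x hx => by simp [hx]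
  rw [← integral_const_mul, ← integral_const_mul,
    ← integral_add (i1.const_mul _) (i2.const_mul _)]
  refine integral_mono_of_nonneg
    (Eventually.of_forall fun x => Finset.sum_nonneg fun _ _ => by positivity)
    ((i1.const_mul _).add (i2.const_mul _)) (Eventually.of_forall fun x => ?_)
  have hN2 : 0 < ‖F x‖ ^ 2 + δ ^ 2 := by positivity
  calc ∑ j, ‖covDeriv ω ε (modulate δ f F) j x‖ ^ 2
      ≤ ∑ j, (2 * ε ^ 2 * fderiv ℝ f x (EuclideanSpace.single j 1) ^ 2
        + 8 * (f x ^ 2 / (‖F x‖ ^ 2 + δ ^ 2)) * ‖covDeriv ω ε F j x‖ ^ 2) := by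
        refine Finset.sum_le_sum fun j _ => ?_
        have h := pow_le_pow_left₀ (norm_nonneg _)
          (norm_covDeriv_modulate_le (ω := ω) hε hδ hf hF j x) 2
        refine h.trans ?_
        have e1 : (ε * |fderiv ℝ f x (EuclideanSpace.single j 1)|) ^ 2
            = ε ^ 2 * fderiv ℝ f x (EuclideanSpace.single j 1) ^ 2 := by
          rw [mul_pow, sq_abs]
        have e2 : (|f x| * ‖covDeriv ω ε F j x‖ / √(‖F x‖ ^ 2 + δ ^ 2)) ^ 2
            = f x ^ 2 / (‖F x‖ ^ 2 + δ ^ 2) * ‖covDeriv ω ε F j x‖ ^ 2 := by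
          rw [div_pow, mul_pow, sq_abs, Real.sq_sqrt hN2.le]; ring
        nlinarith [sq_nonneg (ε * |fderiv ℝ f x (EuclideanSpace.single j 1)|
          - 2 * (|f x| * ‖covDeriv ω ε F j x‖ / √(‖F x‖ ^ 2 + δ ^ 2)))]
    _ = 2 * ε ^ 2 * (∑ j, fderiv ℝ f x (EuclideanSpace.single j 1) ^ 2)
        + 8 * (f x ^ 2 / (‖F x‖ ^ 2 + δ ^ 2)) * ∑ j, ‖covDeriv ω ε F j x‖ ^ 2 := by
        rw [Finset.sum_add_distrib, Finset.mul_sum, Finset.mul_sum]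
    _ ≤ 2 * ε ^ 2 * (∑ j, fderiv ℝ f x (EuclideanSpace.single j 1) ^ 2)
        + 8 * (f x ^ 2 / (‖F x‖ ^ 2 + δ ^ 2)) * D := by
        gcongr; exact hD x
    _ = _ := by simp only; ring

theorem exists_trialState (hW : Coercive (effPotential V ω))
    (hW1 : ContDiff ℝ 1 (effPotential V ω))
    (h1 : ∫ x, tfProfile (effPotential V ω) μ x = 1) :
    ∃ C₁ C₂ : ℝ, 0 ≤ C₂ ∧ ∀ l : ℝ, 0 < l → l ≤ 1 / 2 → C₁ * (l ^ 2 * Real.log (1 / l)) ≤ 1 / 2 →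
      ∃ Ψ : Space → ℂ, ContDiff ℝ 1 Ψ ∧ HasCompactSupport Ψ ∧ ∫ x, ‖Ψ x‖ ^ 2 = 1 ∧
        scaledFunctional V ω (l ^ 2) Ψ ≤ μ - (∫ x, tfProfile (effPotential V ω) μ x ^ 2)
          + C₂ * (l ^ 2 * Real.log (1 / l)) := by
  have hP0 := integral_mul_tfProfile hW hW1.continuous h1
  set W := effPotential V ω with hWdef
  have hWc := hW1.continuous
  obtain ⟨Cf, hCf0, hCf⟩ := exists_integral_fderiv_amplitude_le hW hW1 μ
  obtain ⟨Cd, hCd0, hCd⟩ := exists_integral_tfProfile_sub_amplitude_sq_le hW μ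
  obtain ⟨R, -, hR⟩ := hW μ
  obtain ⟨B', hB'⟩ := (isCompact_closedBall (0 : Space) R).exists_bound_of_continuousOn
    hWc.continuousOn
  set B := max B' 0
  have hB0 : 0 ≤ B := le_max_right _ _
  have hB (x : Space) (hx : W x ≤ μ) : |W x| ≤ B :=
    (hB' x (by simpa using hR x hx)).trans (le_max_left _ _)
  set S := ∫ x, tfProfile W μ x ^ 2
  have hS0 : 0 ≤ S := integral_nonneg fun x => sq_nonneg _
  -- Kinetic constant: `8 * 64 * 256 = 131072` from the derivative bound on the lattice and `I ≤ 256
  -- L`; `4 * Cf` uses `l² ≤ 2 l² L`. `Cm` bounds the mass lost to smoothing and to the vortex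
  -- cores.
  set CT := 4 * Cf + 131072 * (ω ^ 2 + 1)
  set Cm := 2 * Cd + 256
  refine ⟨Cm, 2 * CT + B * Cm + (2 * B + 8 * S) * Cm, by positivity, fun l hl0 hl1 hsmall => ?_⟩
  obtain ⟨hlog2, hlog1⟩ := log_two_div_le hl0 hl1
  set L := Real.log (1 / l)
  have hl2 : 0 < l ^ 2 := by positivity
  have hl2L : l ^ 2 ≤ 2 * (l ^ 2 * L) := by nlinarith
  set f := amplitude W μ (l ^ 2)
  have hf1 : ContDiff ℝ 1 f := contDiff_amplitude hW1 hl2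
  have hfc : HasCompactSupport f := hasCompactSupport_amplitude hW
  have hfcont := hf1.continuous
  have if2 : Integrable fun x => f x ^ 2 :=
    Continuous.integrable_of_hasCompactSupport (by fun_prop)
      (hfc.comp_left (g := fun t : ℝ => t ^ 2) (by simp))
  have iτ : Integrable (tfProfile W μ) := integrable_tfProfile hW hWc
  have hfτ (x : Space) : f x ^ 2 ≤ tfProfile W μ x := amplitude_sq_le hl2 x
  have hf2le : ∫ x, f x ^ 2 ≤ 1 := h1 ▸ integral_mono if2 iτ hfτ
  obtain ⟨a, b, K, hI⟩ := exists_vortexLattice hfcont hfc hf2le ω hl0 (by linarith)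
  set F := vortexLattice ω l a b K
  have hF1 : ContDiff ℝ 1 F := contDiff_vortexLattice
  have hFcont := hF1.continuous
  set I := ∫ x, f x ^ 2 / (‖F x‖ ^ 2 + l ^ 2)
  have hIL : I ≤ 256 * L := by linarith
  set Φ := modulate l f F
  have hΦ1 : ContDiff ℝ 1 Φ := contDiff_modulate hl0 hf1 hF1
  have hΦc : HasCompactSupport Φ := hasCompactSupport_modulate hfc
  have hΦcont := hΦ1.continuous
  have hT : ∫ x, ∑ j, ‖covDeriv ω (l ^ 2) Φ j x‖ ^ 2 ≤ CT * (l ^ 2 * L) := by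
    refine (integral_sum_norm_covDeriv_modulate_sq_le hl2 hl0 hf1 hfc hF1
      (sum_norm_covDeriv_vortexLattice_sq_le hl0)).trans ?_
    have e1 := mul_le_mul_of_nonneg_left (hCf (l ^ 2) hl2) hl2.le
    have e2 := mul_le_mul_of_nonneg_left hl2L hCf0
    have e3 := mul_le_mul_of_nonneg_left hIL
      (by positivity : 0 ≤ 8 * ((64 * ω ^ 2 + 64) * l ^ 2))
    have e4 : 8 * ((64 * ω ^ 2 + 64) * l ^ 2) * (256 * L)
        = 131072 * (ω ^ 2 + 1) * (l ^ 2 * L) := by ring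
    rw [e4] at e3
    refine (add_le_add_right e3 _).trans ?_
    nlinarith
  have hρ (x : Space) : ‖Φ x‖ ^ 2 = f x ^ 2 - l ^ 2 * (f x ^ 2 / (‖F x‖ ^ 2 + l ^ 2)) :=
    norm_sq_modulate hl0 x
  have hρτ (x : Space) : ‖Φ x‖ ^ 2 ≤ tfProfile W μ x := by
    refine le_trans ?_ (hfτ x)
    rw [hρ]
    have : 0 ≤ l ^ 2 * (f x ^ 2 / (‖F x‖ ^ 2 + l ^ 2)) := by positivity
    linarith
  have iρ : Integrable fun x => ‖Φ x‖ ^ 2 :=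
    Continuous.integrable_of_hasCompactSupport (by fun_prop)
      (hΦc.comp_left (g := fun z : ℂ => ‖z‖ ^ 2) (by simp))
  have iI : Integrable fun x => f x ^ 2 / (‖F x‖ ^ 2 + l ^ 2) := by
    have : (fun x => f x ^ 2 / (‖F x‖ ^ 2 + l ^ 2))
        = fun x => (l ^ 2)⁻¹ * (f x ^ 2 - ‖Φ x‖ ^ 2) := by
      funext x; rw [hρ]; field_simp; ring
    rw [this]
    exact (if2.sub iρ).const_mul _
  set m := ∫ x, ‖Φ x‖ ^ 2
  have hm : m = 1 - (∫ x, (tfProfile W μ x - f x ^ 2)) - l ^ 2 * I := by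
    change ∫ x, ‖Φ x‖ ^ 2 = _
    simp only [hρ]
    rw [integral_sub if2 (iI.const_mul _), integral_const_mul, integral_sub iτ if2, h1]
    ring
  have hm1 : m ≤ 1 := h1 ▸ integral_mono iρ iτ hρτ
  have hme : 1 - Cm * (l ^ 2 * L) ≤ m := by
    have e1 := hCd (l ^ 2) hl2
    have e2 := mul_le_mul_of_nonneg_left hl2L hCd0
    have e3 := mul_le_mul_of_nonneg_left hIL hl2.le
    rw [hm]
    nlinarith
  have hm0 : 0 < m := by linarith
  obtain ⟨Ψ, hΨ1, hΨc, hΨn, hΨE⟩ :=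
    exists_normalized (ε := l ^ 2) (V := V) (ω := ω) hWc hΦ1 hΦc hm0 rfl
  refine ⟨Ψ, hΨ1, hΨc, hΨn, hΨE.le.trans ?_⟩
  have hρ0 (x : Space) (hx : μ ≤ W x) : ‖Φ x‖ ^ 2 = 0 := by
    have := hρτ x
    rw [tfProfile_eq_zero hx] at this
    exact le_antisymm this (sq_nonneg _)
  have iWρ : Integrable fun x => W x * ‖Φ x‖ ^ 2 :=
    Continuous.integrable_of_hasCompactSupport (by fun_prop)
      (HasCompactSupport.mul_left (hΦc.comp_left (g := fun z : ℂ => ‖z‖ ^ 2) (by simp)))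
  have hPabs : |∫ x, W x * ‖Φ x‖ ^ 2| ≤ B := by
    calc |∫ x, W x * ‖Φ x‖ ^ 2| ≤ ∫ x, |W x * ‖Φ x‖ ^ 2| := abs_integral_le_integral_abs
      _ ≤ ∫ x, B * ‖Φ x‖ ^ 2 := by
          refine integral_mono iWρ.abs (iρ.const_mul _) fun x => ?_
          simp only
          rw [abs_mul, abs_of_nonneg (sq_nonneg ‖Φ x‖)]
          rcases le_total (W x) μ with h | h
          · exact mul_le_mul_of_nonneg_right (hB x h) (sq_nonneg _)
          · rw [hρ0 x h]; simp
      _ = B * m := integral_const_mul _ _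
      _ ≤ B := mul_le_of_le_one_right hB0 hm1
  -- Since `W ≥ -B` where the profile lives, removing mass raises the potential energy by at most
  -- `B` per unit.
  have hP : ∫ x, W x * ‖Φ x‖ ^ 2 ≤ (μ - 2 * S) + B * (1 - m) := by
    rw [← hP0, ← h1, ← integral_sub iτ iρ, ← integral_const_mul,
      ← integral_add (integrable_mul_tfProfile hW hWc) (by exact (iτ.sub iρ).const_mul _)]
    refine integral_mono iWρ
      ((integrable_mul_tfProfile hW hWc).add ((iτ.sub iρ).const_mul _)) fun x => ?_
    change W x * ‖Φ x‖ ^ 2 ≤ W x * tfProfile W μ x + B * (tfProfile W μ x - ‖Φ x‖ ^ 2)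
    rcases le_total (W x) μ with h | h
    · have h2 := (abs_le.1 (hB x h)).1
      nlinarith [hρτ x]
    · rw [hρ0 x h, tfProfile_eq_zero h]; simp
  have hQ : ∫ x, ‖Φ x‖ ^ 4 ≤ S := by
    refine integral_mono_of_nonneg (Eventually.of_forall fun x => by positivity)
      (integrable_tfProfile_sq hW hWc) (Eventually.of_forall fun x => ?_)
    change ‖Φ x‖ ^ 4 ≤ tfProfile W μ x ^ 2
    rw [show ‖Φ x‖ ^ 4 = (‖Φ x‖ ^ 2) ^ 2 by ring]
    exact pow_le_pow_left₀ (sq_nonneg _) (hρτ x) 2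
  refine (normalized_energy_le hm1 hme hsmall
    (integral_nonneg fun x => Finset.sum_nonneg fun _ _ => by positivity) hB0 hPabs
    (integral_nonneg fun x => by positivity) hQ).trans ?_
  have hBm : B * (1 - m) ≤ B * (Cm * (l ^ 2 * L)) := by gcongr; linarith
  nlinarith

end trial

/-! ### Comparison of the energies and conclusion. -/

lemma gpValues_nonempty {V : Space → ℝ} (hV : Continuous V) (g Ω : ℝ) :
    (gpValues V g Ω).Nonempty := by
  let b : ContDiffBump (0 : Space) := ⟨1, 2, one_pos, one_lt_two⟩
  let Φ : Space → ℂ := fun x => (b x : ℂ)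
  have hΦ1 : ContDiff ℝ 1 Φ := Complex.ofRealCLM.contDiff.comp b.contDiff
  have hΦc : HasCompactSupport Φ := b.hasCompactSupport.comp_left (g := fun t : ℝ => (t : ℂ)) rfl
  have hΦcont := hΦ1.continuous
  have hpos : 0 < ∫ x, ‖Φ x‖ ^ 2 := by
    refine Continuous.integral_pos_of_hasCompactSupport_nonneg_nonzero (x := 0) (by fun_prop)
      (hΦc.comp_left (g := fun z : ℂ => ‖z‖ ^ 2) (by simp)) (fun x => by positivity) ?_
    have : b 0 = 1 := b.one_of_mem_closedBall (by simp [b.rIn_pos.le])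
    simp [Φ, this]
  obtain ⟨Ψ, hΨ1, hΨc, hΨn, -⟩ := exists_normalized (V := V) (ω := Ω) (ε := 1)
    (by unfold effPotential axisDistSq; fun_prop) hΦ1 hΦc hpos rfl
  exact ⟨_, Ψ, _, isGPState_of_contDiff hV Ω hΨ1 hΨc hΨn, rfl⟩

section comparison

variable {V : Space → ℝ} {ω q l : ℝ}

lemma isGLB_gpValues {g Ω : ℝ} (hg : 0 < g) (hV : Continuous V)
    (hW : Coercive (effPotential V Ω)) (hc : Continuous (effPotential V Ω)) :
    IsGLB (gpValues V g Ω) (gpEnergy V g Ω) :=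
  isGLB_csInf (gpValues_nonempty hV g Ω) (bddBelow_gpValues hg.le hW hc)

lemma tfEnergy_le_gpEnergy (hV : Continuous V) (hq : 0 < q) (hl : 0 < l)
    (hVq : ∀ x, V (l • x) = q ^ 2 * l ^ 2 * V x)
    (hW : Coercive (effPotential V ω)) (hc : Continuous (effPotential V ω)) :
    q ^ 2 * l ^ 2 * tfEnergy V 1 ω ≤ gpEnergy V (q ^ 2 * l ^ 5) (q * ω) := by
  refine le_csInf (gpValues_nonempty hV _ _) ?_
  rintro e ⟨ψ, G, h, rfl⟩
  exact tfEnergy_le_of_isGPState hq hl hVq hW hc h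

lemma gpEnergy_le_scaledFunctional (hV : Continuous V) (hq : 0 < q) (hl : 0 < l)
    (hVq : ∀ x, V (l • x) = q ^ 2 * l ^ 2 * V x)
    (hbdd : BddBelow (gpValues V (q ^ 2 * l ^ 5) (q * ω))) {Ψ : Space → ℂ}
    (hΨ : ContDiff ℝ 1 Ψ) (hΨc : HasCompactSupport Ψ) (hΨn : ∫ x, ‖Ψ x‖ ^ 2 = 1) :
    gpEnergy V (q ^ 2 * l ^ 5) (q * ω)
      ≤ q ^ 2 * l ^ 2 * scaledFunctional V ω (q * l ^ 2)⁻¹ Ψ := by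
  rw [← gpFunctional_dilate hq hl hVq hΨ]
  refine csInf_le hbdd ⟨_, _, isGPState_of_contDiff hV _ (contDiff_dilate hΨ)
    (hasCompactSupport_dilate hl hΨc) ?_, rfl⟩
  rw [integral_norm_sq_dilate hl, hΨn]

end comparison

end RotatingBose

open RotatingBose

theorem mainTheorem5 (s : ℝ) (hs : 2 < s) (V : RotatingBose.Space → ℝ)
    (hV : ContDiff ℝ 1 V)
    (hVpos : ∀ x : RotatingBose.Space, ‖x‖ = 1 → 0 < V x)
    (hVhom : ∀ t : ℝ, 0 < t → ∀ x : RotatingBose.Space, V (t • x) = t ^ s * V x)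
    (ω : ℝ) (hω : 0 ≤ ω) :
    IsGLB (RotatingBose.tfValues V 1 ω) (RotatingBose.tfEnergy V 1 ω) ∧
    (∀ g : ℝ, 0 < g →
      IsGLB (RotatingBose.gpValues V g (RotatingBose.angularVelocity s ω g))
        (RotatingBose.gpEnergy V g (RotatingBose.angularVelocity s ω g))) ∧
    (fun g : ℝ =>
        g ^ (-(s / (s + 3))) *
            RotatingBose.gpEnergy V g (RotatingBose.angularVelocity s ω g) -
          RotatingBose.tfEnergy V 1 ω)
      =O[atTop]
        (fun g : ℝ => g ^ (-((s + 2) / (2 * (s + 3)))) * Real.log g) := by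
  have hW (Ω : ℝ) : Coercive (effPotential V Ω) :=
    coercive_effPotential hs hV.continuous hVpos hVhom Ω
  have hW1 (Ω : ℝ) : ContDiff ℝ 1 (effPotential V Ω) := contDiff_effPotential hV Ω
  refine ⟨isGLB_tfValues (hW ω) (hW1 ω).continuous, fun g hg =>
    isGLB_gpValues hg hV.continuous (hW _) (hW1 _).continuous, ?_⟩
  obtain ⟨μ, hμ⟩ := exists_integral_tfProfile_eq_one (hW ω) (hW1 ω).continuous
  obtain ⟨C₁, C₂, hC₂, htrial⟩ := exists_trialState (hW ω) (hW1 ω) hμ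
  have hTF := le_tfEnergy (hW ω) (hW1 ω).continuous hμ
  have hs3 : 0 < s + 3 := by linarith
  obtain ⟨κ, hκ⟩ : ∃ κ, κ = (s + 2) / (2 * (s + 3)) := ⟨_, rfl⟩
  have hκ0 : 0 < κ := by rw [hκ]; apply div_pos <;> linarith
  have hlim1 : Tendsto (fun g : ℝ => g ^ (-(κ / 2))) atTop (nhds 0) :=
    tendsto_rpow_neg_atTop (by linarith)
  have hlim2 : Tendsto (fun g : ℝ => C₁ * (κ / 2 * (g ^ (-κ) * Real.log g))) atTop (nhds 0) := by
    have h : Tendsto (fun g : ℝ => g ^ (-κ) * Real.log g) atTop (nhds 0) := by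
      refine (isLittleO_log_rpow_atTop hκ0).tendsto_div_nhds_zero.congr' ?_
      filter_upwards [eventually_gt_atTop 0] with g hg
      rw [Real.rpow_neg hg.le, div_eq_inv_mul]
    simpa using (h.const_mul (κ / 2)).const_mul C₁
  refine IsBigO.of_bound (C₂ * (κ / 2)) ?_
  filter_upwards [eventually_gt_atTop 1, hlim1.eventually_le_const (by norm_num : (0 : ℝ) < 1 / 2),
    hlim2.eventually_le_const (by norm_num : (0 : ℝ) < 1 / 2)] with g hg1 hlhalf hsmall
  have hg : 0 < g := by linarith
  have hlogg : 0 < Real.log g := Real.log_pos hg1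
  -- This `l` is the dilation length. The lattice mesh, called `l` in `exists_trialState`, is here
  -- `g ^ (-(κ / 2)) = √ε`, so its `l² log (1/l)` equals `κ/2 * g ^ (-κ) * log g`.
  set l := g ^ (1 / (s + 3)) with hl
  set q := g ^ ((s - 2) / (2 * (s + 3))) with hq
  have hl0 : 0 < l := Real.rpow_pos_of_pos hg _
  have hq0 : 0 < q := Real.rpow_pos_of_pos hg _
  have hpow (a : ℝ) (n : ℕ) : (g ^ a) ^ n = g ^ (a * n) := by
    rw [Real.rpow_mul hg.le, Real.rpow_natCast]
  have hql2 : q ^ 2 * l ^ 2 = g ^ (s / (s + 3)) := by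
    rw [hq, hl, hpow, hpow, ← Real.rpow_add hg]
    congr 1; push_cast; field_simp; ring
  have hgq : g = q ^ 2 * l ^ 5 := by
    rw [hq, hl, hpow, hpow, ← Real.rpow_add hg]
    nth_rewrite 1 [← Real.rpow_one g]
    congr 1; push_cast; field_simp; ring
  have hVq (x : Space) : V (l • x) = q ^ 2 * l ^ 2 * V x := by
    rw [hVhom l hl0, hql2, hl, ← Real.rpow_mul hg.le]
    congr 2; field_simp
  have hε : (q * l ^ 2)⁻¹ = (g ^ (-(κ / 2))) ^ 2 := by
    rw [hq, hl, hpow, hpow, ← Real.rpow_add hg, ← Real.rpow_neg hg.le]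
    congr 1; rw [hκ]; push_cast; field_simp; ring
  have hη : (g ^ (-(κ / 2))) ^ 2 * Real.log (1 / g ^ (-(κ / 2)))
      = κ / 2 * (g ^ (-κ) * Real.log g) := by
    rw [Real.log_div one_ne_zero (by positivity), Real.log_one, Real.log_rpow hg, hpow]
    rw [show -(κ / 2) * ((2 : ℕ) : ℝ) = -κ by push_cast; ring]
    ring
  obtain ⟨Ψ, hΨ1, hΨc, hΨn, hΨE⟩ :=
    htrial (g ^ (-(κ / 2))) (by positivity) hlhalf (by rw [hη]; exact hsmall)
  rw [hη, ← hε] at hΨE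
  have hlow := tfEnergy_le_gpEnergy hV.continuous hq0 hl0 hVq (hW ω) (hW1 ω).continuous
  have hup := gpEnergy_le_scaledFunctional (ω := ω) hV.continuous hq0 hl0 hVq
    (bddBelow_gpValues (by positivity) (hW _) (hW1 _).continuous) hΨ1 hΨc hΨn
  rw [← hgq, hql2] at hlow hup
  have hX : 0 < g ^ (s / (s + 3)) := Real.rpow_pos_of_pos hg _
  rw [← hκ, angularVelocity, ← hq, Real.rpow_neg hg.le]
  rw [← le_inv_mul_iff₀ hX] at hlow
  rw [← inv_mul_le_iff₀ hX] at hup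
  have hη0 : 0 ≤ g ^ (-κ) * Real.log g := by positivity
  rw [Real.norm_of_nonneg (sub_nonneg.2 hlow), Real.norm_of_nonneg hη0]
  linarith
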